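/- Let $\mathbb T^2=[0,2\pi]^2$ with periodic boundary conditions, $\hat u(\xi)=(2\pi)^{-2}\int_{\mathbb T^2}e^{-i\xi\cdot(x,y)}u(x,y)\,dx\,dy$ for $\xi\in\mathbb Z^2$, and let $\Lambda$ be the Fourier multiplier $\widehat{\Lambda u}(\xi)=|\xi|\hat u(\xi)$. Let $\varepsilon>0$, $\beta>0$, $\delta\ge 0$ and consider $$\eta_t+\eta\,\eta_x+(\beta-1)\eta_{xx}-\eta_{yy}-\delta\Lambda^3\eta+\varepsilon\Delta^2\eta=0,\quad (x,y)\in\mathbb T^2,\ t>0,\qquad \eta(0)=\eta_0 .\tag{1}$$ By a solution of (1) we mean a real-valued function $\eta\in C([0,T];H^2(\mathbb T^2))\cap L^2(0,T;H^4(\mathbb T^2))$ for every $T>0$ which satisfies the equation in the sense of distributions and the initial condition. **Theorem.** Let $\eta_0\in H^2(\mathbb T^2)$ be real-valued and odd in $x$, i.e. $\eta_0(-x,y)=-\eta_0(x,y)$. Then there are $T_0>0$ and a constant $C$, both depending only on $\eta_0,\varepsilon,\beta,\delta$, such that the solution $\eta$ of (1) satisfies $\|\eta(t)\|_{L^2}\le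 C$ for all $t\ge 0$ and $$\|e^{\sigma(t)\Lambda}\eta(t)\|_{L^2}^2=4\pi^2\sum_{\xi\in\mathbb Z^2}e^{2\sigma(t)|\xi|}|\hat\eta(\xi,t)|^2\le 1+2C^2\quad\text{for all }t>0,\qquad \sigma(t)=\min\{\tanh t,\tanh(T_0/2)\}.$$ In particular, for every $t>0$ the function $\eta(t)$ extends to a complex analytic function on the strip $\{(x,y)+i(x',y'):(x,y),(x',y')\in\mathbb R^2,\ |(x',y')|<\sigma(t)\}$, which has the fixed width $\tanh(T_0/2)$ for all $t\ge T_0/2$. -/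

import Mathlib

open MeasureTheory Filter Topology
open scoped ENNReal

noncomputable section

instance fact_two_pi_pos : Fact (0 < 2 * Real.pi) := ⟨Real.two_pi_pos⟩

/-- The torus `[0, 2π]²` with periodic boundary conditions, with Lebesgue measure (total mass
`4π²`). -/
abbrev Torus2 : Type := AddCircle (2 * Real.pi) × AddCircle (2 * Real.pi)

/-- Real-valued `L²` functions on the torus. -/
abbrev L2Torus : Type := Lp ℝ 2 (volume : Measure Torus2)

/-- Fourier coefficient `(2π)⁻² ∫ e^{-i ξ₁ x - i ξ₂ y} f(x, y) dx dy`. -/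
def fourierCoeff2 (f : Torus2 → ℝ) (ξ : ℤ × ℤ) : ℂ :=
  (((2 * Real.pi) ^ 2)⁻¹ : ℝ) *
    ∫ p : Torus2, fourier (-ξ.1) p.1 * fourier (-ξ.2) p.2 * (f p : ℂ)

/-- Euclidean length `|ξ|` of a frequency: the symbol of `Λ`. -/
def freqNorm (ξ : ℤ × ℤ) : ℝ := Real.sqrt ((ξ.1 : ℝ) ^ 2 + (ξ.2 : ℝ) ^ 2)

/-- The squared Sobolev norm `4π² ∑ (1 + |ξ|²)^s |û(ξ)|²`, with value `∞` when `u ∉ H^s`. -/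
def sobolevSq (s : ℕ) (u : L2Torus) : ℝ≥0∞ :=
  ∑' ξ : ℤ × ℤ, ENNReal.ofReal
    ((2 * Real.pi) ^ 2 * ((1 + freqNorm ξ ^ 2) ^ s * ‖fourierCoeff2 u ξ‖ ^ 2))

/-- The squared Gevrey norm `‖e^{σΛ} u‖²_{L²} = 4π² ∑ e^{2σ|ξ|} |û(ξ)|²`, with value `∞` when
`e^{σΛ} u ∉ L²`. -/
def gevreySq (σ : ℝ) (u : L2Torus) : ℝ≥0∞ :=
  ∑' ξ : ℤ × ℤ, ENNReal.ofReal
    ((2 * Real.pi) ^ 2 * (Real.exp (2 * σ * freqNorm ξ) * ‖fourierCoeff2 u ξ‖ ^ 2))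

/-- The space `H²_od`: functions in `H²` of the torus that are odd in `x`. -/
def IsH2Odd (u : L2Torus) : Prop :=
  sobolevSq 2 u < ⊤ ∧ ∀ᵐ p : Torus2, u (-p.1, p.2) = -u p

/-- Fourier symbol of the linear operator
`η ↦ -(β - 1) η_xx + η_yy + δ Λ³ η - ε Δ² η`. -/
def linearSymbol (ε β δ : ℝ) (ξ : ℤ × ℤ) : ℝ :=
  (β - 1) * (ξ.1 : ℝ) ^ 2 - (ξ.2 : ℝ) ^ 2 + δ * freqNorm ξ ^ 3 - ε * freqNorm ξ ^ 4

/-- `η` is a global solution, in `C([0,T]; H²) ∩ L²(0,T; H⁴)` for every `T > 0`, of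
`η_t + η η_x + (β - 1) η_xx - η_yy - δ Λ³ η + ε Δ² η = 0`, `η(0) = η₀`.
The equation holds in the sense of distributions on the torus, integrated in time: it is tested
against every character `e^{-i ξ·x}`, with `η η_x = (η²)_x / 2`. -/
structure IsSolution (ε β δ : ℝ) (η₀ : L2Torus) (η : ℝ → L2Torus) : Prop where
  initial : η 0 = η₀
  mem_H2 : ∀ t, 0 ≤ t → sobolevSq 2 (η t) < ⊤
  continuous_H2 : ∀ t, 0 ≤ t →
    Tendsto (fun s => sobolevSq 2 (η s - η t)) (𝓝[Set.Ici 0] t) (𝓝 0)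
  memL2_H4 : ∀ T, 0 < T → ∫⁻ t in Set.Ioc 0 T, sobolevSq 4 (η t) < ⊤
  equation : ∀ t, 0 ≤ t → ∀ ξ : ℤ × ℤ,
    fourierCoeff2 (η t) ξ = fourierCoeff2 η₀ ξ +
      ∫ s in (0 : ℝ)..t,
        (-(Complex.I * (ξ.1 : ℂ) / 2) * fourierCoeff2 (fun p => (η s p) ^ 2) ξ
          + (linearSymbol ε β δ ξ : ℂ) * fourierCoeff2 (η s) ξ)

/-- The strip `{(x, y) + i (x', y') : |(x', y')| < r}` in `ℂ²`. -/
def complexStrip (r : ℝ) : Set (ℂ × ℂ) :=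
  {z | Real.sqrt (z.1.im ^ 2 + z.2.im ^ 2) < r}

/-- `u` has a (complex) analytic extension to the strip of width `r`. -/
def AnalyticInStrip (r : ℝ) (u : L2Torus) : Prop :=
  ∃ F : ℂ × ℂ → ℂ, AnalyticOnNhd ℂ F (complexStrip r) ∧
    ∀ᵐ p : ℝ × ℝ, F ((p.1 : ℂ), (p.2 : ℂ)) =
      ((u ((p.1 : AddCircle (2 * Real.pi)), (p.2 : AddCircle (2 * Real.pi))) : ℝ) : ℂ)

/-- The width `σ(t) = min {tanh t, tanh (T₀ / 2)}`. -/
def stripWidth (T₀ t : ℝ) : ℝ := min (Real.tanh t) (Real.tanh (T₀ / 2))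

end

/-!
Fourier coefficients turn the equation into `a_t = -∂ₓ(u²)/2 + L a` with a symbol `L` equal to
`-ε |ξ|⁴` up to cubic terms. The nonlinearity drops out of the `L²` balance, but low modes may still
be amplified. To damp them, pair the equation with a multiple of the truncated sawtooth
`∑_{1 ≤ k ≤ N} sin (k x) / k`. Its derivative is, up to constants, a Dirichlet kernel minus `1`. The
kernel concentrates at `x = 0`, where an odd `u` vanishes, so for large `N` its pairing with `u²` is
an arbitrarily small multiple of `‖Δu‖²`, which the dissipation absorbs. What remains is the mean of
`u²` with a favourable sign: damping of any prescribed strength, hence a uniform-in-time `L²` bound.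

The Gevrey norm with weight `e ^ (2 t |ξ|)` satisfies a differential inequality on `[0, τ]` with `τ`
depending only on the `L²` norm of the data; subadditivity of `|ξ|` distributes the weight over the
product. Restarting at time `t - min t τ` gives the bound at every `t > 0`, and exponential decay of
the Fourier coefficients makes the Fourier series converge to an analytic function on the strip.
-/

open scoped ComplexConjugate

/-- The real family `f` is summable with sum at most `B`. Bundling the two facts lets estimates of
sums be chained without separate summability side conditions. -/
def SumLE {ι : Type*} (f : ι → ℝ) (B : ℝ) : Prop := Summable f ∧ ∑' i, f i ≤ B

namespace SumLE

variable {ι κ : Type*} {f g : ι → ℝ} {A B : ℝ}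

theorem summable (h : SumLE f B) : Summable f := h.1

theorem tsum_le (h : SumLE f B) : ∑' i, f i ≤ B := h.2

theorem of_hasSum (h : HasSum f B) : SumLE f B := ⟨h.summable, h.tsum_eq.le⟩

theorem nonneg (h : SumLE f B) (hf : ∀ i, 0 ≤ f i) : 0 ≤ B := (tsum_nonneg hf).trans h.2

theorem sum_le (h : SumLE f B) (hf : ∀ i, 0 ≤ f i) (s : Finset ι) : ∑ i ∈ s, f i ≤ B :=
  (h.1.sum_le_tsum s fun i _ ↦ hf i).trans h.2

theorem of_sum_le (hf : ∀ i, 0 ≤ f i) (h : ∀ s : Finset ι, ∑ i ∈ s, f i ≤ B) : SumLE f B :=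
  have hs := summable_of_sum_le hf h
  ⟨hs, hs.tsum_le_of_sum_le h⟩

theorem of_le (h : SumLE g B) (hf : ∀ i, 0 ≤ f i) (hfg : ∀ i, f i ≤ g i) : SumLE f B :=
  have hs := h.1.of_nonneg_of_le hf hfg
  ⟨hs, (hs.tsum_le_tsum hfg h.1).trans h.2⟩

theorem add (hf : SumLE f A) (hg : SumLE g B) : SumLE (fun i ↦ f i + g i) (A + B) :=
  ⟨hf.1.add hg.1, by rw [hf.1.tsum_add hg.1]; exact add_le_add hf.2 hg.2⟩

theorem const_mul (hf : SumLE f B) {c : ℝ} (hc : 0 ≤ c) : SumLE (fun i ↦ c * f i) (c * B) :=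
  ⟨hf.1.mul_left c, by rw [tsum_mul_left]; exact mul_le_mul_of_nonneg_left hf.2 hc⟩

theorem comp_equiv (hf : SumLE f B) (e : κ ≃ ι) : SumLE (fun k ↦ f (e k)) B :=
  ⟨e.summable_iff.mpr hf.1, (e.tsum_eq f).trans_le hf.2⟩

theorem prod_of_nonneg {F : ι × κ → ℝ} {b : ι → ℝ} (hF : ∀ p, 0 ≤ F p)
    (hfiber : ∀ i, SumLE (fun k ↦ F (i, k)) (b i)) (hb : SumLE b B) : SumLE F B := by
  have hsum := hb.of_le (fun i ↦ tsum_nonneg fun k ↦ hF (i, k)) fun i ↦ (hfiber i).2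
  have hF' : Summable F := (summable_prod_of_nonneg hF).mpr ⟨fun i ↦ (hfiber i).1, hsum.1⟩
  exact ⟨hF', hF'.tsum_prod.trans_le hsum.2⟩

theorem tsum_fiber {F : ι × κ → ℝ} (hF : SumLE F B) : SumLE (fun i ↦ ∑' k, F (i, k)) B :=
  ⟨hF.1.prod, hF.1.tsum_prod.ge.trans hF.2⟩

theorem mul_of_sq (hf : SumLE (fun i ↦ f i ^ 2) A) (hg : SumLE (fun i ↦ g i ^ 2) B) :
    SumLE (fun i ↦ f i * g i) (√A * √B) := by
  have habs : SumLE (fun i ↦ |f i| * |g i|) (√A * √B) := by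
    refine of_sum_le (fun i ↦ by positivity) fun s ↦
      (Real.sum_mul_le_sqrt_mul_sqrt s _ _).trans ?_
    simp only [sq_abs]
    gcongr
    · exact hf.sum_le (fun i ↦ sq_nonneg _) s
    · exact hg.sum_le (fun i ↦ sq_nonneg _) s
  have hle : ∀ i, f i * g i ≤ |f i| * |g i| := fun i ↦ (le_abs_self _).trans_eq (abs_mul _ _)
  have hs : Summable fun i ↦ f i * g i :=
    habs.1.of_norm_bounded fun i ↦ (abs_mul (f i) (g i)).le
  exact ⟨hs, (hs.tsum_le_tsum hle habs.1).trans habs.2⟩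

theorem of_weighted_sq {w : ι → ℝ} (hw : ∀ i, 0 < w i) (hA : SumLE (fun i ↦ (w i)⁻¹) A)
    (hf : SumLE (fun i ↦ w i * f i ^ 2) B) : SumLE f (√A * √B) := by
  have h1 : SumLE (fun i ↦ √(w i)⁻¹ ^ 2) A := by
    simpa only [Real.sq_sqrt (inv_nonneg.mpr (hw _).le)] using hA
  have h2 : SumLE (fun i ↦ (√(w i) * f i) ^ 2) B := by
    simpa only [mul_pow, Real.sq_sqrt (hw _).le] using hf
  have hcancel : ∀ i, √(w i)⁻¹ * (√(w i) * f i) = f i := fun i ↦ by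
    rw [Real.sqrt_inv, inv_mul_cancel_left₀ (Real.sqrt_pos.mpr (hw i)).ne']
  simpa only [hcancel] using mul_of_sq h1 h2

end SumLE

section Convolution

variable {G R : Type*} [AddCommGroup G]

/-- The convolution `(f ∗ g)(ξ) = ∑ f(ζ) g(ξ - ζ)` of two families on a discrete group. -/
noncomputable def conv [NonUnitalNonAssocSemiring R] [TopologicalSpace R] (f g : G → R) (ξ : G) :
    R :=
  ∑' ζ, f ζ * g (ξ - ζ)

theorem conv_comm [NonUnitalCommSemiring R] [TopologicalSpace R] (f g : G → R) :
    conv f g = conv g f := by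
  ext ξ
  rw [conv, ← (Equiv.subLeft ξ).tsum_eq]
  exact tsum_congr fun ζ ↦ by simp [mul_comm]

theorem conv_comp_addEquiv [NonUnitalNonAssocSemiring R] [TopologicalSpace R] (f g : G → R)
    (e : G ≃+ G) : conv (f ∘ e) (g ∘ e) = conv f g ∘ e := by
  ext ξ
  simp only [conv, Function.comp_apply, map_sub]
  exact e.toEquiv.tsum_eq fun ζ ↦ f ζ * g (e ξ - ζ)

section Real

variable {f d g : G → ℝ} {A B D : ℝ}

theorem SumLE.conv_apply (hf : SumLE (fun ξ ↦ f ξ ^ 2) A) (hg : SumLE (fun ξ ↦ g ξ ^ 2) B)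
    (ξ : G) : SumLE (fun ζ ↦ f ζ * g (ξ - ζ)) (√A * √B) :=
  hf.mul_of_sq (hg.comp_equiv (Equiv.subLeft ξ))

theorem SumLE.mul_conv (hf0 : ∀ ξ, 0 ≤ f ξ) (hd0 : ∀ ξ, 0 ≤ d ξ) (hg0 : ∀ ξ, 0 ≤ g ξ)
    (hf : SumLE (fun ξ ↦ f ξ ^ 2) A) (hd : SumLE d D) (hg : SumLE (fun ξ ↦ g ξ ^ 2) B) :
    SumLE (fun ξ ↦ f ξ * conv d g ξ) (√A * √B * D) := by
  have hfiber : ∀ ζ, SumLE (fun ξ ↦ d ζ * (f ξ * g (ξ - ζ))) (d ζ * (√A * √B)) := fun ζ ↦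
    (hf.mul_of_sq (hg.comp_equiv (Equiv.subRight ζ))).const_mul (hd0 ζ)
  have hprod : SumLE (fun p : G × G ↦ d p.1 * (f p.2 * g (p.2 - p.1))) (√A * √B * D) :=
    SumLE.prod_of_nonneg (fun p ↦ mul_nonneg (hd0 _) (mul_nonneg (hf0 _) (hg0 _))) hfiber
      (by simpa only [mul_comm] using hd.const_mul (by positivity : 0 ≤ √A * √B))
  simpa [conv, ← tsum_mul_left, mul_left_comm] using
    (hprod.comp_equiv (Equiv.prodComm G G)).tsum_fiber

end Real

variable [NormedCommRing R] {a b c : G → R} {A B : ℝ}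

theorem norm_conv_le_conv_norm (ha : Summable fun ξ ↦ ‖a ξ‖ ^ 2)
    (hb : Summable fun ξ ↦ ‖b ξ‖ ^ 2) (ξ : G) :
    ‖conv a b ξ‖ ≤ conv (fun ζ ↦ ‖a ζ‖) (fun ζ ↦ ‖b ζ‖) ξ :=
  tsum_of_norm_bounded
    ((SumLE.of_hasSum ha.hasSum).conv_apply (SumLE.of_hasSum hb.hasSum) ξ).1.hasSum
    fun _ ↦ norm_mul_le _ _

theorem norm_conv_le (ha : SumLE (fun ξ ↦ ‖a ξ‖ ^ 2) A) (hb : SumLE (fun ξ ↦ ‖b ξ‖ ^ 2) B)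
    (ξ : G) : ‖conv a b ξ‖ ≤ √A * √B :=
  (norm_conv_le_conv_norm ha.1 hb.1 ξ).trans (ha.conv_apply hb ξ).2

variable [CompleteSpace R]

theorem summable_conv_apply (ha : Summable fun ξ ↦ ‖a ξ‖ ^ 2) (hb : Summable fun ξ ↦ ‖b ξ‖ ^ 2)
    (ξ : G) : Summable fun ζ ↦ a ζ * b (ξ - ζ) :=
  ((SumLE.of_hasSum ha.hasSum).conv_apply (SumLE.of_hasSum hb.hasSum) ξ).1.of_norm_bounded
    fun _ ↦ norm_mul_le _ _

theorem conv_sub_add (ha : Summable fun ξ ↦ ‖a ξ‖ ^ 2) (hb : Summable fun ξ ↦ ‖b ξ‖ ^ 2) :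
    conv (a - b) (a + b) = conv a a - conv b b := by
  ext ξ
  have hsum := ((summable_conv_apply ha ha ξ).hasSum.sub (summable_conv_apply hb hb ξ).hasSum).add
    ((summable_conv_apply ha hb ξ).hasSum.sub (summable_conv_apply hb ha ξ).hasSum)
  have hcomm : ∑' ζ, a ζ * b (ξ - ζ) = ∑' ζ, b ζ * a (ξ - ζ) := congrFun (conv_comm a b) ξ
  rw [hcomm, sub_self, add_zero] at hsum
  exact (hsum.congr_fun fun ζ ↦ by simp only [Pi.sub_apply, Pi.add_apply]; ring).tsum_eq

end Convolution

section Frequencies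

theorem freqNorm_eq_norm (ξ : ℤ × ℤ) :
    freqNorm ξ = ‖((ξ.1 : ℝ) : ℂ) + ((ξ.2 : ℝ) : ℂ) * Complex.I‖ := by
  rw [Complex.norm_add_mul_I, freqNorm]

theorem freqNorm_nonneg (ξ : ℤ × ℤ) : 0 ≤ freqNorm ξ := Real.sqrt_nonneg _

theorem freqNorm_add_le (ξ ζ : ℤ × ℤ) : freqNorm (ξ + ζ) ≤ freqNorm ξ + freqNorm ζ := by
  simp only [freqNorm_eq_norm]
  refine (congrArg norm ?_).trans_le (norm_add_le _ _)
  push_cast [Prod.fst_add, Prod.snd_add]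
  ring

theorem abs_fst_le_freqNorm (ξ : ℤ × ℤ) : |(ξ.1 : ℝ)| ≤ freqNorm ξ :=
  Real.abs_le_sqrt (le_add_of_nonneg_right (sq_nonneg _))

theorem abs_snd_le_freqNorm (ξ : ℤ × ℤ) : |(ξ.2 : ℝ)| ≤ freqNorm ξ :=
  Real.abs_le_sqrt (le_add_of_nonneg_left (sq_nonneg _))

/-- The inhomogeneous frequency weight `1 + |ξ|`. -/
noncomputable def freqWeight (ξ : ℤ × ℤ) : ℝ := 1 + freqNorm ξ

theorem one_le_freqWeight (ξ : ℤ × ℤ) : 1 ≤ freqWeight ξ :=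
  le_add_of_nonneg_right (freqNorm_nonneg ξ)

theorem freqWeight_pos (ξ : ℤ × ℤ) : 0 < freqWeight ξ := zero_lt_one.trans_le (one_le_freqWeight ξ)

theorem freqNorm_le_freqWeight (ξ : ℤ × ℤ) : freqNorm ξ ≤ freqWeight ξ :=
  le_add_of_nonneg_left zero_le_one

theorem freqWeight_pow_le_pow {m n : ℕ} (hmn : m ≤ n) (ξ : ℤ × ℤ) :
    freqWeight ξ ^ m ≤ freqWeight ξ ^ n :=
  pow_le_pow_right₀ (one_le_freqWeight ξ) hmn

theorem freqNorm_pow_le_freqWeight_pow {m n : ℕ} (hmn : m ≤ n) (ξ : ℤ × ℤ) :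
    freqNorm ξ ^ m ≤ freqWeight ξ ^ n :=
  (pow_le_pow_left₀ (freqNorm_nonneg ξ) (freqNorm_le_freqWeight ξ) m).trans
    (freqWeight_pow_le_pow hmn ξ)

theorem summable_one_add_abs_int_rpow {p : ℝ} (hp : p < -1) :
    Summable fun m : ℤ ↦ (1 + |(m : ℝ)|) ^ p := by
  have h : Summable fun n : ℕ ↦ (1 + (n : ℝ)) ^ p := by
    simpa [add_comm] using (summable_nat_add_iff 1).mpr (Real.summable_nat_rpow.mpr hp)
  refine Summable.of_nat_of_neg ?_ ?_ <;> simpa using h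

theorem summable_freqWeight_cube_inv : Summable fun ξ ↦ (freqWeight ξ ^ 3)⁻¹ := by
  have hint := summable_one_add_abs_int_rpow (p := -(3 / 2)) (by norm_num)
  have hpos : ∀ m : ℤ, (0 : ℝ) ≤ (1 + |(m : ℝ)|) ^ (-(3 / 2) : ℝ) := fun m ↦ by positivity
  refine (hint.mul_of_nonneg hint hpos hpos).of_nonneg_of_le
    (fun ξ ↦ by have := freqWeight_pos ξ; positivity) fun ξ ↦ ?_
  have hW := freqWeight_pos ξ
  have hsplit : (freqWeight ξ ^ 3)⁻¹ =
      freqWeight ξ ^ (-(3 / 2) : ℝ) * freqWeight ξ ^ (-(3 / 2) : ℝ) := by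
    rw [← Real.rpow_add hW, ← Real.rpow_natCast, ← Real.rpow_neg hW.le]
    norm_num
  rw [hsplit]
  gcongr ?_ * ?_
  · exact Real.rpow_le_rpow_of_nonpos (by positivity)
      (add_le_add_right (abs_fst_le_freqNorm ξ) 1) (by norm_num)
  · exact Real.rpow_le_rpow_of_nonpos (by positivity)
      (add_le_add_right (abs_snd_le_freqNorm ξ) 1) (by norm_num)

/-- The sum `∑ (1 + |ξ|)⁻³`, whose square root is the constant of the embedding of the Wiener
algebra into the weighted `ℓ²` space with weight `(1 + |ξ|)³`. -/
noncomputable def weightConst : ℝ := ∑' ξ, (freqWeight ξ ^ 3)⁻¹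

theorem SumLE.of_freqWeight_cube {b : ℤ × ℤ → ℝ} {B : ℝ}
    (hb : SumLE (fun ξ ↦ freqWeight ξ ^ 3 * b ξ ^ 2) B) : SumLE b (√weightConst * √B) :=
  of_weighted_sq (fun ξ ↦ pow_pos (freqWeight_pos ξ) 3)
    (of_hasSum summable_freqWeight_cube_inv.hasSum) hb

theorem SumLE.freqWeight_pow_mono {b : ℤ × ℤ → ℝ} {B : ℝ} {m n : ℕ} (hmn : m ≤ n)
    (hb : SumLE (fun ξ ↦ freqWeight ξ ^ n * b ξ ^ 2) B) :
    SumLE (fun ξ ↦ freqWeight ξ ^ m * b ξ ^ 2) B :=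
  hb.of_le (fun ξ ↦ by have := freqWeight_pos ξ; positivity) fun ξ ↦
    mul_le_mul_of_nonneg_right (freqWeight_pow_le_pow hmn ξ) (sq_nonneg _)

theorem SumLE.freqNorm_pow {b : ℤ × ℤ → ℝ} {B : ℝ} {n : ℕ}
    (hb : SumLE (fun ξ ↦ freqWeight ξ ^ n * b ξ ^ 2) B) :
    SumLE (fun ξ ↦ freqNorm ξ ^ n * b ξ ^ 2) B :=
  hb.of_le (fun ξ ↦ by have := freqNorm_nonneg ξ; positivity) fun ξ ↦
    mul_le_mul_of_nonneg_right (freqNorm_pow_le_freqWeight_pow le_rfl ξ) (sq_nonneg _)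

theorem SumLE.sq_of_freqWeight_pow {b : ℤ × ℤ → ℝ} {B : ℝ} {n : ℕ}
    (hb : SumLE (fun ξ ↦ freqWeight ξ ^ n * b ξ ^ 2) B) : SumLE (fun ξ ↦ b ξ ^ 2) B := by
  simpa using hb.freqWeight_pow_mono n.zero_le

/-- The reflection `(ξ₁, ξ₂) ↦ (-ξ₁, ξ₂)`, dual to `x ↦ -x`. -/
def reflectFst : ℤ × ℤ ≃+ ℤ × ℤ := (AddEquiv.neg ℤ).prodCongr (AddEquiv.refl ℤ)

@[simp] theorem reflectFst_apply (ξ : ℤ × ℤ) : reflectFst ξ = (-ξ.1, ξ.2) := rfl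

theorem freqNorm_reflectFst (ξ : ℤ × ℤ) : freqNorm (reflectFst ξ) = freqNorm ξ := by
  simp [freqNorm]

theorem freqWeight_reflectFst (ξ : ℤ × ℤ) : freqWeight (reflectFst ξ) = freqWeight ξ := by
  rw [freqWeight, freqNorm_reflectFst, freqWeight]

end Frequencies

section Symbols

/-- A symbol of the form `-ε |ξ|⁴ + O((1 + |ξ|)³)` with `ε > 0`, even in the first frequency: up to
lower order terms the operator is `-ε Δ²`, and it preserves oddness in `x`. -/
structure IsBiharmonicSymbol (ε : ℝ) (L : ℤ × ℤ → ℝ) : Prop where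
  pos : 0 < ε
  even_fst : ∀ ξ, L (reflectFst ξ) = L ξ
  lower_order : ∃ A, ∀ ξ, |L ξ + ε * freqNorm ξ ^ 4| ≤ A * freqWeight ξ ^ 3

theorem isBiharmonicSymbol_linearSymbol {ε : ℝ} (hε : 0 < ε) (β δ : ℝ) :
    IsBiharmonicSymbol ε (linearSymbol ε β δ) where
  pos := hε
  even_fst ξ := by rw [linearSymbol, freqNorm_reflectFst, linearSymbol]; simp
  lower_order := by
    refine ⟨|β - 1| + 1 + |δ|, fun ξ ↦ ?_⟩
    have h1 : |(ξ.1 : ℝ)| ^ 2 ≤ freqWeight ξ ^ 3 :=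
      (pow_le_pow_left₀ (abs_nonneg _) (abs_fst_le_freqNorm ξ) 2).trans
        (freqNorm_pow_le_freqWeight_pow (by norm_num) ξ)
    have h2 : |(ξ.2 : ℝ)| ^ 2 ≤ freqWeight ξ ^ 3 :=
      (pow_le_pow_left₀ (abs_nonneg _) (abs_snd_le_freqNorm ξ) 2).trans
        (freqNorm_pow_le_freqWeight_pow (by norm_num) ξ)
    have h3 : |freqNorm ξ| ^ 3 ≤ freqWeight ξ ^ 3 := by
      rw [abs_of_nonneg (freqNorm_nonneg ξ)]
      exact freqNorm_pow_le_freqWeight_pow le_rfl ξ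
    calc |linearSymbol ε β δ ξ + ε * freqNorm ξ ^ 4|
        = |(β - 1) * (ξ.1 : ℝ) ^ 2 - (ξ.2 : ℝ) ^ 2 + δ * freqNorm ξ ^ 3| := by
          rw [linearSymbol, sub_add_cancel]
      _ ≤ |β - 1| * |(ξ.1 : ℝ)| ^ 2 + |(ξ.2 : ℝ)| ^ 2 + |δ| * |freqNorm ξ| ^ 3 := by
          simp only [← abs_pow, ← abs_mul]
          exact (abs_add_le _ _).trans (add_le_add_left (abs_sub _ _) _)
      _ ≤ |β - 1| * freqWeight ξ ^ 3 + freqWeight ξ ^ 3 + |δ| * freqWeight ξ ^ 3 := by gcongr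
      _ = (|β - 1| + 1 + |δ|) * freqWeight ξ ^ 3 := by ring

theorem exists_mul_one_add_cube_le (P : ℝ) {ε : ℝ} (hε : 0 < ε) :
    ∃ K, 0 ≤ K ∧ ∀ x : ℝ, 0 ≤ x → P * (1 + x) ^ 3 ≤ K + ε * x ^ 4 := by
  refine ⟨|P| * (8 * |P| / ε) ^ 3 + ε, by positivity, fun x hx ↦ ?_⟩
  have hP : P * (1 + x) ^ 3 ≤ |P| * (1 + x) ^ 3 := by gcongr; exact le_abs_self P
  have hfourth : (1 + x) ^ 4 ≤ 8 * (1 + x ^ 4) := by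
    simpa [add_comm, show (2 : ℝ) ^ 3 = 8 by norm_num] using add_pow_le zero_le_one hx 4
  refine hP.trans ?_
  rcases le_or_gt (1 + x) (8 * |P| / ε) with h | h
  · have : |P| * (1 + x) ^ 3 ≤ |P| * (8 * |P| / ε) ^ 3 := by gcongr
    have : 0 ≤ ε * x ^ 4 := by positivity
    linarith
  · rw [div_lt_iff₀ hε] at h
    calc |P| * (1 + x) ^ 3 ≤ (1 + x) * ε / 8 * (1 + x) ^ 3 := by gcongr; linarith
      _ = ε / 8 * (1 + x) ^ 4 := by ring
      _ ≤ ε / 8 * (8 * (1 + x ^ 4)) := by gcongr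
      _ ≤ |P| * (8 * |P| / ε) ^ 3 + ε + ε * x ^ 4 := by
          linarith [show 0 ≤ |P| * (8 * |P| / ε) ^ 3 by positivity]

namespace IsBiharmonicSymbol

variable {ε : ℝ} {L : ℤ × ℤ → ℝ}

theorem exists_add_cube_le (hL : IsBiharmonicSymbol ε L) (P : ℝ) :
    ∃ K, 0 ≤ K ∧ ∀ ξ, L ξ + P * freqWeight ξ ^ 3 ≤ K - ε / 2 * freqNorm ξ ^ 4 := by
  obtain ⟨A, hA⟩ := hL.lower_order
  obtain ⟨K, hK, h⟩ := exists_mul_one_add_cube_le (A + P) (half_pos hL.pos)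
  refine ⟨K, hK, fun ξ ↦ ?_⟩
  have h1 := h (freqNorm ξ) (freqNorm_nonneg ξ)
  have h2 := (abs_le.mp (hA ξ)).2
  rw [← freqWeight] at h1
  linarith

theorem exists_abs_le (hL : IsBiharmonicSymbol ε L) :
    ∃ M, 0 ≤ M ∧ ∀ ξ, |L ξ| ≤ M * freqWeight ξ ^ 4 := by
  obtain ⟨A, hA⟩ := hL.lower_order
  refine ⟨|A| + ε, by have := hL.pos; positivity, fun ξ ↦ ?_⟩
  have hN : |ε * freqNorm ξ ^ 4| ≤ ε * freqWeight ξ ^ 4 := by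
    rw [abs_of_nonneg (by have := hL.pos; have := freqNorm_nonneg ξ; positivity)]
    exact mul_le_mul_of_nonneg_left (freqNorm_pow_le_freqWeight_pow le_rfl ξ) hL.pos.le
  have hA' : A * freqWeight ξ ^ 3 ≤ |A| * freqWeight ξ ^ 4 :=
    mul_le_mul (le_abs_self A) (freqWeight_pow_le_pow (by norm_num) ξ)
      (pow_nonneg (freqWeight_pos ξ).le 3) (abs_nonneg A)
  have hsub := abs_sub (L ξ + ε * freqNorm ξ ^ 4) (ε * freqNorm ξ ^ 4)
  rw [add_sub_cancel_right] at hsub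
  linarith [hA ξ]

end IsBiharmonicSymbol

end Symbols

section TorusCharacters

open Submodule

/-- The character `(x, y) ↦ e^{i ξ₁ x + i ξ₂ y}` of the torus. -/
noncomputable def torusChar (ξ : ℤ × ℤ) : C(Torus2, ℂ) where
  toFun p := fourier ξ.1 p.1 * fourier ξ.2 p.2
  continuous_toFun := by fun_prop

theorem torusChar_apply (ξ : ℤ × ℤ) (p : Torus2) :
    torusChar ξ p = fourier ξ.1 p.1 * fourier ξ.2 p.2 := rfl

@[simp] theorem torusChar_zero (p : Torus2) : torusChar 0 p = 1 := by simp [torusChar_apply]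

theorem torusChar_neg (ξ : ℤ × ℤ) (p : Torus2) : torusChar (-ξ) p = conj (torusChar ξ p) := by
  simp only [torusChar_apply, Prod.fst_neg, Prod.snd_neg, fourier_neg, map_mul]

theorem torusChar_add (ξ ζ : ℤ × ℤ) (p : Torus2) :
    torusChar (ξ + ζ) p = torusChar ξ p * torusChar ζ p := by
  simp only [torusChar_apply, Prod.fst_add, Prod.snd_add, fourier_add]
  ring

theorem norm_torusChar_apply (ξ : ℤ × ℤ) (p : Torus2) : ‖torusChar ξ p‖ = 1 := by
  simp only [torusChar_apply, fourier_apply, norm_mul, Circle.norm_coe, one_mul]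

theorem integral_fourier (n : ℤ) :
    ∫ x : AddCircle (2 * Real.pi), fourier n x = if n = 0 then ((2 * Real.pi : ℝ) : ℂ) else 0 := by
  have h := congrFun (fourierCoeff_fourier (T := 2 * Real.pi) n) 0
  rw [fourierCoeff, AddCircle.integral_haarAddCircle] at h
  simp only [neg_zero, fourier_zero, one_smul] at h
  rw [inv_smul_eq_iff₀ Real.two_pi_pos.ne'] at h
  rw [h]
  by_cases hn : n = 0
  · simp [hn]
  · rw [if_neg hn, Pi.single_eq_of_ne (Ne.symm hn), smul_zero]

theorem integral_torusChar (ξ : ℤ × ℤ) :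
    ∫ p, torusChar ξ p = if ξ = 0 then ((2 * Real.pi : ℝ) : ℂ) ^ 2 else 0 := by
  have hprod := integral_prod_mul (μ := (volume : Measure (AddCircle (2 * Real.pi))))
    (ν := (volume : Measure (AddCircle (2 * Real.pi))))
    (fun x ↦ (fourier ξ.1 x : ℂ)) (fun x ↦ (fourier ξ.2 x : ℂ))
  simp only [torusChar_apply]
  rw [Measure.volume_eq_prod, hprod, integral_fourier, integral_fourier]
  by_cases hm : ξ.1 = 0 <;> by_cases hn : ξ.2 = 0 <;> simp [Prod.ext_iff, hm, hn, pow_two]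

/-- The trigonometric polynomials, as a star subalgebra of the continuous functions on the
torus. -/
noncomputable def torusCharSubalgebra : StarSubalgebra ℂ C(Torus2, ℂ) where
  toSubalgebra := Algebra.adjoin ℂ (Set.range torusChar)
  star_mem' := by
    change Algebra.adjoin ℂ (Set.range torusChar) ≤ star (Algebra.adjoin ℂ (Set.range torusChar))
    refine Algebra.adjoin_le ?_
    rintro _ ⟨n, rfl⟩
    refine Algebra.subset_adjoin ⟨-n, ?_⟩
    ext1 x
    simp only [torusChar_neg, starRingEnd_apply, ContinuousMap.star_apply]

theorem torusCharSubalgebra_coe :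
    torusCharSubalgebra.toSubalgebra.toSubmodule = span ℂ (Set.range torusChar) := by
  apply Algebra.adjoin_eq_span_of_subset
  refine .trans (fun x ↦ Submonoid.closure_induction (fun _ ↦ id) ⟨0, ?_⟩ ?_) subset_span
  · ext z
    simp
  · rintro _ _ _ _ ⟨m, rfl⟩ ⟨n, rfl⟩
    refine ⟨m + n, ?_⟩
    ext z
    simp [torusChar_add]

theorem torusCharSubalgebra_separatesPoints : torusCharSubalgebra.SeparatesPoints := by
  intro x y hxy
  have hinj := (AddCircle.injective_toCircle (T := 2 * Real.pi) Real.two_pi_pos.ne')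
  by_cases h1 : x.1 = y.1
  · refine ⟨_, ⟨torusChar (0, 1), Algebra.subset_adjoin ⟨(0, 1), rfl⟩, rfl⟩, fun h ↦ ?_⟩
    simp only [torusChar_apply, fourier_zero, fourier_one, one_mul] at h
    exact hxy (Prod.ext h1 (hinj (Subtype.coe_injective h)))
  · refine ⟨_, ⟨torusChar (1, 0), Algebra.subset_adjoin ⟨(1, 0), rfl⟩, rfl⟩, fun h ↦ ?_⟩
    simp only [torusChar_apply, fourier_zero, fourier_one, mul_one] at h
    exact h1 (hinj (Subtype.coe_injective h))

theorem span_torusChar_closure_eq_top :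
    (span ℂ (Set.range torusChar)).topologicalClosure = ⊤ := by
  rw [← torusCharSubalgebra_coe]
  exact congr_arg (Subalgebra.toSubmodule <| StarSubalgebra.toSubalgebra ·)
    (ContinuousMap.starSubalgebra_topologicalClosure_eq_top_of_separatesPoints _
      torusCharSubalgebra_separatesPoints)

theorem two_pi_ne_zero_complex : ((2 * Real.pi : ℝ) : ℂ) ≠ 0 :=
  Complex.ofReal_ne_zero.mpr Real.two_pi_pos.ne'

/-- The characters normalised in `L²` of the torus. -/
noncomputable def torusCharLp (ξ : ℤ × ℤ) : Lp ℂ 2 (volume : Measure Torus2) :=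
  ((2 * Real.pi : ℝ) : ℂ)⁻¹ • ContinuousMap.toLp (E := ℂ) 2 volume ℂ (torusChar ξ)

theorem span_torusCharLp_closure_eq_top :
    (span ℂ (Set.range torusCharLp)).topologicalClosure = ⊤ := by
  have h := (ContinuousMap.toLp_denseRange ℂ (volume : Measure Torus2) ℂ
    (p := 2) (by simp)).topologicalClosure_map_submodule span_torusChar_closure_eq_top
  rw [map_span, ← Set.range_comp,
    ← span_smul_eq_of_isUnit _ _ (inv_ne_zero two_pi_ne_zero_complex).isUnit,
    Set.smul_set_range] at h
  exact h

theorem orthonormal_torusCharLp : Orthonormal ℂ torusCharLp := by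
  rw [orthonormal_iff_ite]
  intro ξ ζ
  have h2pi := two_pi_ne_zero_complex
  rw [torusCharLp, torusCharLp, inner_smul_left, inner_smul_right, ContinuousMap.inner_toLp]
  simp only [← torusChar_neg, ← torusChar_add, integral_torusChar, add_neg_eq_zero, map_inv₀,
    Complex.conj_ofReal, eq_comm (a := ζ)]
  split_ifs
  · field_simp
  · simp

/-- The Hilbert basis of normalised characters of `L²` of the torus. -/
noncomputable def torusBasis : HilbertBasis (ℤ × ℤ) ℂ (Lp ℂ 2 (volume : Measure Torus2)) :=
  HilbertBasis.mk orthonormal_torusCharLp span_torusCharLp_closure_eq_top.ge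

theorem torusBasis_apply (ξ : ℤ × ℤ) : torusBasis ξ = torusCharLp ξ := by
  rw [torusBasis, HilbertBasis.coe_mk]

theorem coeFn_torusBasis (ξ : ℤ × ℤ) :
    torusBasis ξ =ᵐ[volume] fun p ↦ ((2 * Real.pi : ℝ) : ℂ)⁻¹ * torusChar ξ p := by
  rw [torusBasis_apply, torusCharLp, ← map_smul]
  exact ContinuousMap.coeFn_toLp (E := ℂ) (𝕜 := ℂ) (p := 2) (volume : Measure Torus2) _

end TorusCharacters

section FourierCoefficients

/-- The Fourier coefficient `(2π)⁻² ∫ e^{-i ξ·p} F(p) dp` of a complex function on the torus. -/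
noncomputable def torusCoeff (F : Torus2 → ℂ) (ξ : ℤ × ℤ) : ℂ :=
  (((2 * Real.pi) ^ 2)⁻¹ : ℝ) * ∫ p, torusChar (-ξ) p * F p

theorem fourierCoeff2_eq_torusCoeff (f : Torus2 → ℝ) :
    fourierCoeff2 f = torusCoeff fun p ↦ (f p : ℂ) := rfl

variable {F G : Torus2 → ℂ}

theorem torusCoeff_conj (F : Torus2 → ℂ) (ξ : ℤ × ℤ) :
    torusCoeff (fun p ↦ conj (F p)) ξ = conj (torusCoeff F (-ξ)) := by
  simp only [torusCoeff, map_mul, Complex.conj_ofReal, ← integral_conj, torusChar_neg, neg_neg]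

theorem torusCoeff_torusChar_mul (F : Torus2 → ℂ) (ξ ζ : ℤ × ℤ) :
    torusCoeff (fun p ↦ torusChar ζ p * F p) ξ = torusCoeff F (ξ - ζ) := by
  simp only [torusCoeff, ← mul_assoc, ← torusChar_add, neg_sub, neg_add_eq_sub]

theorem inner_torusBasis_toLp (hF : MemLp F 2) (ξ : ℤ × ℤ) :
    inner ℂ (torusBasis ξ) (hF.toLp F) = ((2 * Real.pi : ℝ) : ℂ) * torusCoeff F ξ := by
  have h : inner ℂ (torusBasis ξ) (hF.toLp F) =
      ((2 * Real.pi : ℝ) : ℂ)⁻¹ * ∫ p, torusChar (-ξ) p * F p := by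
    rw [L2.inner_def, ← integral_const_mul]
    refine integral_congr_ae ?_
    filter_upwards [coeFn_torusBasis ξ, hF.coeFn_toLp] with p hp hp'
    rw [hp, hp', RCLike.inner_apply, map_mul, map_inv₀, Complex.conj_ofReal, torusChar_neg]
    ring
  have h2pi := two_pi_ne_zero_complex
  rw [h, torusCoeff, Complex.ofReal_inv, Complex.ofReal_pow]
  field_simp

theorem hasSum_conj_torusCoeff_mul (hF : MemLp F 2) (hG : MemLp G 2) :
    HasSum (fun ξ ↦ conj (torusCoeff F ξ) * torusCoeff G ξ)
      (torusCoeff (fun p ↦ conj (F p) * G p) 0) := by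
  have hinner : inner ℂ (hF.toLp F) (hG.toLp G) = ∫ p, conj (F p) * G p := by
    rw [L2.inner_def]
    refine integral_congr_ae ?_
    filter_upwards [hF.coeFn_toLp, hG.coeFn_toLp] with p hp hp'
    rw [hp, hp', RCLike.inner_apply, mul_comm]
  have h := (torusBasis.hasSum_inner_mul_inner (hF.toLp F) (hG.toLp G)).mul_left
    ((((2 * Real.pi) ^ 2)⁻¹ : ℝ) : ℂ)
  have hzero : torusCoeff (fun p ↦ conj (F p) * G p) 0 =
      ((((2 * Real.pi) ^ 2)⁻¹ : ℝ) : ℂ) * ∫ p, conj (F p) * G p := by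
    simp only [torusCoeff, neg_zero, torusChar_zero, one_mul]
  rw [hinner, ← hzero] at h
  refine h.congr_fun fun ξ ↦ ?_
  have h2pi := two_pi_ne_zero_complex
  rw [← inner_conj_symm, inner_torusBasis_toLp, inner_torusBasis_toLp, map_mul,
    Complex.conj_ofReal, Complex.ofReal_inv, Complex.ofReal_pow]
  field_simp

theorem torusCoeff_mul (hF : MemLp F 2) (hG : MemLp G 2) :
    torusCoeff (fun p ↦ F p * G p) = conv (torusCoeff F) (torusCoeff G) := by
  ext ξ
  have hF' : MemLp (fun p ↦ torusChar ξ p * conj (F p)) 2 := by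
    refine hF.of_le ((torusChar ξ).continuous.aestronglyMeasurable.mul
      (Complex.continuous_conj.comp_aestronglyMeasurable hF.1)) (Eventually.of_forall fun p ↦ ?_)
    rw [norm_mul, norm_torusChar_apply, one_mul, RCLike.norm_conj]
  have h := (hasSum_conj_torusCoeff_mul hF' hG).tsum_eq
  simp only [torusCoeff_torusChar_mul, torusCoeff_conj, map_mul, Complex.conj_conj,
    ← torusChar_neg, mul_assoc, zero_sub, neg_neg, neg_sub] at h
  rw [conv_comm, conv, ← h]
  exact tsum_congr fun ζ ↦ mul_comm _ _

theorem memLp_ofReal (u : L2Torus) : MemLp (fun p ↦ ((u p : ℝ) : ℂ)) 2 (volume : Measure Torus2) :=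
  (Lp.memLp u).ofReal

theorem fourierCoeff2_mul (u v : L2Torus) :
    fourierCoeff2 (fun p ↦ u p * v p) = conv (fourierCoeff2 u) (fourierCoeff2 v) := by
  simpa only [fourierCoeff2_eq_torusCoeff, Complex.ofReal_mul] using
    torusCoeff_mul (memLp_ofReal u) (memLp_ofReal v)

theorem fourierCoeff2_neg (f : Torus2 → ℝ) (ξ : ℤ × ℤ) :
    fourierCoeff2 f (-ξ) = conj (fourierCoeff2 f ξ) := by
  simpa only [← fourierCoeff2_eq_torusCoeff, neg_neg, Complex.conj_ofReal] using
    torusCoeff_conj (fun p ↦ (f p : ℂ)) (-ξ)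

theorem fourierCoeff2_add (u v : L2Torus) (ξ : ℤ × ℤ) :
    fourierCoeff2 (u + v : L2Torus) ξ = fourierCoeff2 u ξ + fourierCoeff2 v ξ := by
  have h2pi := two_pi_ne_zero_complex
  have hadd : (memLp_ofReal u).toLp _ + (memLp_ofReal v).toLp _ =
      (memLp_ofReal (u + v)).toLp _ := by
    rw [← MemLp.toLp_add]
    refine MemLp.toLp_congr _ _ ?_
    filter_upwards [Lp.coeFn_add u v] with p hp
    simp only [Pi.add_apply, hp, Complex.ofReal_add]
  have h := congrArg (inner ℂ (torusBasis ξ)) hadd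
  rw [inner_add_right] at h
  simp only [inner_torusBasis_toLp, ← mul_add] at h
  exact (mul_left_cancel₀ h2pi h).symm

theorem fourierCoeff2_sub (u v : L2Torus) (ξ : ℤ × ℤ) :
    fourierCoeff2 (u - v : L2Torus) ξ = fourierCoeff2 u ξ - fourierCoeff2 v ξ := by
  rw [eq_sub_iff_add_eq, ← fourierCoeff2_add, sub_add_cancel]

theorem hasSum_norm_sq_fourierCoeff2 (u : L2Torus) :
    HasSum (fun ξ ↦ ‖fourierCoeff2 u ξ‖ ^ 2) (((2 * Real.pi) ^ 2)⁻¹ * ‖u‖ ^ 2) := by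
  have h := hasSum_conj_torusCoeff_mul (memLp_ofReal u) (memLp_ofReal u)
  have hnorm : torusCoeff (fun p ↦ conj ((u p : ℝ) : ℂ) * ((u p : ℝ) : ℂ)) 0 =
      ((((2 * Real.pi) ^ 2)⁻¹ * ‖u‖ ^ 2 : ℝ) : ℂ) := by
    rw [← real_inner_self_eq_norm_sq, L2.inner_def, torusCoeff, Complex.ofReal_mul,
      ← integral_complex_ofReal]
    simp [← pow_two]
  rw [hnorm] at h
  refine Complex.hasSum_ofReal.mp (h.congr_fun fun ξ ↦ ?_)
  rw [Complex.conj_mul', ← Complex.ofReal_pow, fourierCoeff2_eq_torusCoeff]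

theorem continuous_fourierCoeff2 (ξ : ℤ × ℤ) : Continuous fun u : L2Torus ↦ fourierCoeff2 u ξ := by
  refine LipschitzWith.continuous (K := (2 * Real.pi)⁻¹.toNNReal)
    (LipschitzWith.of_dist_le_mul fun u v ↦ ?_)
  have h := le_hasSum (hasSum_norm_sq_fourierCoeff2 (u - v)) ξ fun _ _ ↦ sq_nonneg _
  rw [← inv_pow, ← mul_pow, fourierCoeff2_sub] at h
  rw [dist_eq_norm, dist_eq_norm, Real.coe_toNNReal _ (by positivity)]
  exact le_of_sq_le_sq h (by positivity)

theorem fourierCoeff2_reflectFst (u : L2Torus) (hu : ∀ᵐ p : Torus2, u (-p.1, p.2) = -u p)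
    (ξ : ℤ × ℤ) : fourierCoeff2 u (reflectFst ξ) = -fourierCoeff2 u ξ := by
  let e : Torus2 ≃ᵐ Torus2 := (MeasurableEquiv.neg _).prodCongr (MeasurableEquiv.refl _)
  have he : MeasurePreserving e volume volume :=
    (Measure.measurePreserving_neg (volume : Measure (AddCircle (2 * Real.pi)))).prod
      (MeasurePreserving.id _)
  rw [fourierCoeff2_eq_torusCoeff, torusCoeff, torusCoeff, ← mul_neg, ← integral_neg,
    ← he.integral_comp e.measurableEmbedding]
  congr 1
  refine integral_congr_ae ?_
  filter_upwards [hu] with p hp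
  change torusChar _ (-p.1, p.2) * ((u (-p.1, p.2) : ℝ) : ℂ) = _
  rw [hp]
  simp [torusChar_apply, fourier_apply]

theorem ae_eq_tsum_torusChar (u : L2Torus) (hu : Summable fun ξ ↦ ‖fourierCoeff2 u ξ‖) :
    ∀ᵐ p : Torus2, ((u p : ℝ) : ℂ) = ∑' ξ, fourierCoeff2 u ξ * torusChar ξ p := by
  set U := (memLp_ofReal u).toLp _ with hU
  have hs : Summable fun ξ ↦ fourierCoeff2 u ξ • torusChar ξ := by
    refine hu.of_norm_bounded fun ξ ↦ ?_
    rw [norm_smul]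
    exact mul_le_of_le_one_right (norm_nonneg _)
      ((ContinuousMap.norm_le _ zero_le_one).mpr fun p ↦ (norm_torusChar_apply ξ p).le)
  have hterm : ∀ ξ, ContinuousMap.toLp (E := ℂ) 2 volume ℂ (fourierCoeff2 u ξ • torusChar ξ) =
      torusBasis.repr U ξ • torusBasis ξ := fun ξ ↦ by
    have h2pi := two_pi_ne_zero_complex
    rw [HilbertBasis.repr_apply_apply, hU, inner_torusBasis_toLp, torusBasis_apply, torusCharLp,
      map_smul, smul_smul, fourierCoeff2_eq_torusCoeff]
    congr 1
    field_simp
  have hLp := (ContinuousMap.toLp (E := ℂ) 2 (volume : Measure Torus2) ℂ).hasSum hs.hasSum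
  simp only [hterm] at hLp
  have hsum := ContinuousMap.coeFn_toLp (E := ℂ) (𝕜 := ℂ) (p := 2) (volume : Measure Torus2)
    (∑' ξ, fourierCoeff2 u ξ • torusChar ξ)
  rw [← (torusBasis.hasSum_repr U).unique hLp] at hsum
  filter_upwards [(memLp_ofReal u).coeFn_toLp, hsum] with p hp hp'
  rw [← hp, hp']
  exact ((ContinuousMap.evalCLM ℂ p).hasSum hs.hasSum).tsum_eq.symm

end FourierCoefficients

/-- `y` is a primitive of the integrable function `G` on `[a, b]`. -/
def IsPrimitiveOn (y G : ℝ → ℝ) (a b : ℝ) : Prop :=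
  IntervalIntegrable G volume a b ∧ ∀ t ∈ Set.Icc a b, y t = y a + ∫ s in a..t, G s

namespace IsPrimitiveOn

variable {y G z H : ℝ → ℝ} {a b : ℝ}

theorem continuousOn (h : IsPrimitiveOn y G a b) (hab : a ≤ b) : ContinuousOn y (Set.Icc a b) := by
  have hint := intervalIntegral.continuousOn_primitive_interval' h.1 Set.left_mem_uIcc
  rw [Set.uIcc_of_le hab] at hint
  exact (continuousOn_const.add hint).congr h.2

theorem intervalIntegrable (h : IsPrimitiveOn y G a b) {c : ℝ} (hc : c ∈ Set.Icc a b) :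
    IntervalIntegrable G volume a c :=
  h.1.mono_set (Set.uIcc_subset_uIcc_left (Set.Icc_subset_uIcc hc))

theorem sub_eq (h : IsPrimitiveOn y G a b) {s t : ℝ} (hs : s ∈ Set.Icc a b)
    (ht : t ∈ Set.Icc a b) : y t - y s = ∫ r in s..t, G r := by
  rw [h.2 t ht, h.2 s hs, ← intervalIntegral.integral_interval_sub_left
    (h.intervalIntegrable ht) (h.intervalIntegrable hs)]
  ring

theorem add (hy : IsPrimitiveOn y G a b) (hz : IsPrimitiveOn z H a b) :
    IsPrimitiveOn (fun t ↦ y t + z t) (fun t ↦ G t + H t) a b := by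
  refine ⟨hy.1.add hz.1, fun t ht ↦ ?_⟩
  simp only [intervalIntegral.integral_add (hy.intervalIntegrable ht) (hz.intervalIntegrable ht),
    hy.2 t ht, hz.2 t ht]
  ring

theorem of_hasDerivAt (hab : a ≤ b) (hy : ContinuousOn y (Set.Icc a b))
    (hG : ContinuousOn G (Set.Icc a b)) (hd : ∀ t ∈ Set.Ioo a b, HasDerivAt y (G t) t) :
    IsPrimitiveOn y G a b := by
  have hint : ∀ t ∈ Set.Icc a b, IntervalIntegrable G volume a t := fun t ht ↦
    (hG.mono (Set.Icc_subset_Icc_right ht.2)).intervalIntegrable_of_Icc ht.1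
  refine ⟨hint b ⟨hab, le_rfl⟩, fun t ht ↦ ?_⟩
  rw [intervalIntegral.integral_eq_sub_of_hasDerivAt_of_le ht.1
    (hy.mono (Set.Icc_subset_Icc_right ht.2))
    (fun s hs ↦ hd s ⟨hs.1, hs.2.trans_le ht.2⟩) (hint t ht)]
  ring

end IsPrimitiveOn

section TermwiseIntegration

variable {ι : Type*} [Countable ι] {g : ι → ℝ → ℝ} {a b B : ℝ}

theorem integrable_tsum_of_sumLE {α : Type*} [MeasurableSpace α] {μ : Measure α}
    [IsFiniteMeasure μ] {g : ι → α → ℝ} (hg : ∀ i, AEStronglyMeasurable (g i) μ)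
    (hgB : ∀ᵐ s ∂μ, SumLE (fun i ↦ ‖g i s‖) B) : Integrable (fun s ↦ ∑' i, g i s) μ := by
  refine Integrable.mono' (integrable_const B) ?_ ?_
  · refine aestronglyMeasurable_of_tendsto_ae (atTop : Filter (Finset ι))
      (f := fun u s ↦ ∑ i ∈ u, g i s)
      (fun u ↦ Finset.aestronglyMeasurable_fun_sum u fun i _ ↦ hg i) ?_
    filter_upwards [hgB] with s hs using hs.summable.of_norm.hasSum
  · filter_upwards [hgB] with s hs using (norm_tsum_le_tsum_norm hs.summable).trans hs.tsum_le

theorem hasSum_integral_of_sumLE {α : Type*} [MeasurableSpace α] {μ : Measure α}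
    [IsFiniteMeasure μ] {g : ι → α → ℝ} (hg : ∀ i, Integrable (g i) μ)
    (hgB : ∀ᵐ s ∂μ, SumLE (fun i ↦ ‖g i s‖) B) :
    HasSum (fun i ↦ ∫ s, g i s ∂μ) (∫ s, ∑' i, g i s ∂μ) := by
  refine hasSum_integral_of_summable_integral_norm hg (summable_of_sum_le
    (c := ∫ _, B ∂μ) (fun i ↦ integral_nonneg fun s ↦ norm_nonneg _) fun u ↦ ?_)
  rw [← integral_finsetSum _ fun i _ ↦ (hg i).norm]
  refine integral_mono_ae (integrable_finsetSum _ fun i _ ↦ (hg i).norm) (integrable_const _) ?_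
  filter_upwards [hgB] with s hs using hs.sum_le (fun i ↦ norm_nonneg _) u

theorem IsPrimitiveOn.tsum {f : ι → ℝ → ℝ} (hab : a ≤ b)
    (hfg : ∀ i, IsPrimitiveOn (f i) (g i) a b)
    (hf : ∀ t ∈ Set.Icc a b, Summable fun i ↦ f i t)
    (hg : ∀ t ∈ Set.Icc a b, SumLE (fun i ↦ |g i t|) B) :
    IsPrimitiveOn (fun t ↦ ∑' i, f i t) (fun t ↦ ∑' i, g i t) a b := by
  have hint (t : ℝ) (ht : t ∈ Set.Icc a b) (i : ι) : IntegrableOn (g i) (Set.Ioc a t) :=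
    (intervalIntegrable_iff_integrableOn_Ioc_of_le ht.1).mp ((hfg i).intervalIntegrable ht)
  have hbound (t : ℝ) (ht : t ∈ Set.Icc a b) :
      ∀ᵐ s ∂volume.restrict (Set.Ioc a t), SumLE (fun i ↦ ‖g i s‖) B :=
    (ae_restrict_iff' measurableSet_Ioc).mpr
      (Eventually.of_forall fun s hs ↦ hg s ⟨hs.1.le, hs.2.trans ht.2⟩)
  have hb : b ∈ Set.Icc a b := ⟨hab, le_rfl⟩
  refine ⟨(intervalIntegrable_iff_integrableOn_Ioc_of_le hab).mpr
    (integrable_tsum_of_sumLE (fun i ↦ (hint b hb i).1) (hbound b hb)), fun t ht ↦ ?_⟩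
  have hterm (i : ι) : ∫ s in Set.Ioc a t, g i s = f i t - f i a := by
    rw [← intervalIntegral.integral_of_le ht.1, (hfg i).2 t ht]
    ring
  have hsum := (hasSum_integral_of_sumLE (hint t ht) (hbound t ht)).tsum_eq
  simp only [hterm] at hsum
  rw [(hf t ht).tsum_sub (hf a ⟨le_rfl, hab⟩)] at hsum
  rw [intervalIntegral.integral_of_le ht.1, ← hsum]
  ring

end TermwiseIntegration

namespace IsPrimitiveOn

variable {y G : ℝ → ℝ} {a b M : ℝ}

theorem le_of_nonpos_above (h : IsPrimitiveOn y G a b) (ha : y a ≤ M)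
    (hG : ∀ t ∈ Set.Icc a b, M < y t → G t ≤ 0) {t : ℝ} (ht : t ∈ Set.Icc a b) : y t ≤ M := by
  by_contra! hlt
  have hcont : ContinuousOn y (Set.Icc a t) :=
    (h.continuousOn (ht.1.trans ht.2)).mono (Set.Icc_subset_Icc_right ht.2)
  obtain ⟨s, ⟨hs, hsM⟩, hmax⟩ := (isCompact_Icc.of_isClosed_subset
    (hcont.preimage_isClosed_of_isClosed isClosed_Icc (isClosed_Iic (a := M)))
    Set.inter_subset_left).exists_isGreatest ⟨a, ⟨le_rfl, ht.1⟩, ha⟩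
  have hnonpos : ∫ r in s..t, G r ≤ 0 := by
    rw [intervalIntegral.integral_of_le hs.2]
    refine setIntegral_nonpos measurableSet_Ioc fun r hr ↦
      hG r ⟨hs.1.trans hr.1.le, hr.2.trans ht.2⟩ ?_
    by_contra! hrM
    exact (hmax ⟨⟨hs.1.trans hr.1.le, hr.2⟩, hrM⟩).not_gt hr.1
  have hsub := h.sub_eq ⟨hs.1, hs.2.trans ht.2⟩ ht
  have hsM' : y s ≤ M := hsM
  linarith

theorem le_of_le_below (h : IsPrimitiveOn y G a b) {B₀ B : ℝ} (hM : 0 ≤ M) (ha : y a ≤ B₀)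
    (hG : ∀ t ∈ Set.Icc a b, y t ≤ B → G t ≤ M) (hB : B₀ + M * (b - a) < B) {t : ℝ}
    (ht : t ∈ Set.Icc a b) : y t ≤ B := by
  by_contra! hlt
  have hcont : ContinuousOn y (Set.Icc a t) :=
    (h.continuousOn (ht.1.trans ht.2)).mono (Set.Icc_subset_Icc_right ht.2)
  obtain ⟨s, ⟨hs, hsB⟩, hmin⟩ := (isCompact_Icc.of_isClosed_subset
    (hcont.preimage_isClosed_of_isClosed isClosed_Icc (isClosed_Ici (a := B)))
    Set.inter_subset_left).exists_isLeast ⟨t, ⟨ht.1, le_rfl⟩, hlt.le⟩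
  have hsab : s ∈ Set.Icc a b := ⟨hs.1, hs.2.trans ht.2⟩
  have hle : ∫ r in a..s, G r ≤ ∫ _ in a..s, M := by
    refine intervalIntegral.integral_mono_on_of_le_Ioo hs.1 (h.intervalIntegrable hsab)
      intervalIntegrable_const fun r hr ↦ hG r ⟨hr.1.le, hr.2.le.trans hsab.2⟩ ?_
    by_contra! hrB
    exact (hmin ⟨⟨hr.1.le, hr.2.le.trans hs.2⟩, hrB.le⟩).not_gt hr.2
  rw [intervalIntegral.integral_const, smul_eq_mul] at hle
  have hmono : (s - a) * M ≤ M * (b - a) := by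
    rw [mul_comm]
    gcongr
    exact hsab.2
  have hsB' : B ≤ y s := hsB
  linarith [h.2 s hsab]

end IsPrimitiveOn

section SpectralFlows

/-- The Fourier transform of `-∂ₓ q / 2 + L u`, where `x` and `Q` are the Fourier coefficients of
`u` and `q`, and `L` is a Fourier multiplier. -/
noncomputable def spectralRhs (L : ℤ × ℤ → ℝ) (x Q : ℤ × ℤ → ℂ) (ξ : ℤ × ℤ) : ℂ :=
  -(Complex.I * (ξ.1 : ℂ) / 2) * Q ξ + (L ξ : ℂ) * x ξ

/-- On `[a, b]` the Fourier coefficients `x` solve `u_t = -∂ₓ q / 2 + L u`, where `Q` are the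
Fourier coefficients of `q`, and they are regular enough for energy estimates. -/
structure IsSpectralFlow (L : ℤ × ℤ → ℝ) (x Q : ℝ → ℤ × ℤ → ℂ) (a b : ℝ) : Prop where
  continuousOn : ∀ ξ, ContinuousOn (fun t ↦ x t ξ) (Set.Icc a b)
  continuousOn_force : ∀ ξ, ContinuousOn (fun t ↦ Q t ξ) (Set.Icc a b)
  hasDerivAt : ∀ ξ, ∀ t ∈ Set.Ioo a b,
    HasDerivAt (fun t ↦ x t ξ) (spectralRhs L (x t) (Q t) ξ) t
  bounded : ∃ B, ∀ t ∈ Set.Icc a b, SumLE (fun ξ ↦ freqWeight ξ ^ 4 * ‖x t ξ‖ ^ 2) B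
  bounded_force : ∃ B, ∀ t ∈ Set.Icc a b, SumLE (fun ξ ↦ freqNorm ξ * ‖x t ξ‖ * ‖Q t ξ‖) B

/-- A global solution, on the Fourier side, of `u_t = -∂ₓ (u²) / 2 + L u` with real `u`. -/
structure IsSpectralSolution (L : ℤ × ℤ → ℝ) (a : ℝ → ℤ × ℤ → ℂ) : Prop where
  isSpectralFlow : ∀ T, IsSpectralFlow L a (fun t ↦ conv (a t) (a t)) 0 T
  neg : ∀ t ξ, a t (-ξ) = conj (a t ξ)

theorem SumLE.freqNorm_mul_conv {f d g : ℤ × ℤ → ℝ} {A B D : ℝ} (hf0 : ∀ ξ, 0 ≤ f ξ)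
    (hd0 : ∀ ξ, 0 ≤ d ξ) (hg0 : ∀ ξ, 0 ≤ g ξ) (hf : SumLE (fun ξ ↦ freqWeight ξ ^ 3 * f ξ ^ 2) A)
    (hd : SumLE d D) (hg : SumLE (fun ξ ↦ g ξ ^ 2) B) :
    SumLE (fun ξ ↦ freqNorm ξ * f ξ * conv d g ξ) (√A * √B * D) := by
  refine SumLE.mul_conv (fun ξ ↦ mul_nonneg (freqNorm_nonneg ξ) (hf0 ξ)) hd0 hg0
    (hf.of_le (fun ξ ↦ sq_nonneg _) fun ξ ↦ ?_) hd hg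
  rw [mul_pow]
  gcongr
  exact freqNorm_pow_le_freqWeight_pow (by norm_num) ξ

theorem SumLE.freqNorm_mul_norm_conv {x d g : ℤ × ℤ → ℂ} {A B D : ℝ}
    (hx : SumLE (fun ξ ↦ freqWeight ξ ^ 3 * ‖x ξ‖ ^ 2) A)
    (hd : SumLE (fun ξ ↦ freqWeight ξ ^ 3 * ‖d ξ‖ ^ 2) D) (hg : SumLE (fun ξ ↦ ‖g ξ‖ ^ 2) B) :
    SumLE (fun ξ ↦ freqNorm ξ * ‖x ξ‖ * ‖conv d g ξ‖) (√A * √B * (√weightConst * √D)) := by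
  refine (SumLE.freqNorm_mul_conv (fun _ ↦ norm_nonneg _) (fun _ ↦ norm_nonneg _)
    (fun _ ↦ norm_nonneg _) hx hd.of_freqWeight_cube hg).of_le
    (fun ξ ↦ by have := freqNorm_nonneg ξ; positivity) fun ξ ↦ ?_
  have := freqNorm_nonneg ξ
  gcongr
  exact norm_conv_le_conv_norm hd.sq_of_freqWeight_pow.summable hg.summable ξ

namespace IsSpectralFlow

variable {L : ℤ × ℤ → ℝ} {x Q : ℝ → ℤ × ℤ → ℂ} {a b : ℝ}

theorem mono (h : IsSpectralFlow L x Q a b) {c d : ℝ} (hc : a ≤ c) (hd : d ≤ b) :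
    IsSpectralFlow L x Q c d := by
  obtain ⟨B, hB⟩ := h.bounded
  obtain ⟨B', hB'⟩ := h.bounded_force
  have hsub : Set.Icc c d ⊆ Set.Icc a b := Set.Icc_subset_Icc hc hd
  exact ⟨fun ξ ↦ (h.continuousOn ξ).mono hsub, fun ξ ↦ (h.continuousOn_force ξ).mono hsub,
    fun ξ t ht ↦ h.hasDerivAt ξ t (Set.Ioo_subset_Ioo hc hd ht), ⟨B, fun t ht ↦ hB t (hsub ht)⟩,
    ⟨B', fun t ht ↦ hB' t (hsub ht)⟩⟩

theorem continuousOn_spectralRhs (h : IsSpectralFlow L x Q a b) (ξ : ℤ × ℤ) :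
    ContinuousOn (fun t ↦ spectralRhs L (x t) (Q t) ξ) (Set.Icc a b) :=
  (continuousOn_const.mul (h.continuousOn_force ξ)).add (continuousOn_const.mul (h.continuousOn ξ))

end IsSpectralFlow

end SpectralFlows

section Solutions

variable {ε β δ : ℝ} {η₀ : L2Torus} {η : ℝ → L2Torus}

theorem fourierCoeff2_sq (u : L2Torus) :
    fourierCoeff2 (fun p ↦ u p ^ 2) = conv (fourierCoeff2 u) (fourierCoeff2 u) := by
  simpa only [pow_two] using fourierCoeff2_mul u u

theorem norm_conv_fourierCoeff2_sub_le (u v : L2Torus) (ξ : ℤ × ℤ) :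
    ‖conv (fourierCoeff2 u) (fourierCoeff2 u) ξ - conv (fourierCoeff2 v) (fourierCoeff2 v) ξ‖ ≤
      ((2 * Real.pi) ^ 2)⁻¹ * ‖u - v‖ * ‖u + v‖ := by
  have hsub : fourierCoeff2 (u - v : L2Torus) = fourierCoeff2 u - fourierCoeff2 v :=
    funext (fourierCoeff2_sub u v)
  have hadd : fourierCoeff2 (u + v : L2Torus) = fourierCoeff2 u + fourierCoeff2 v :=
    funext (fourierCoeff2_add u v)
  rw [← Pi.sub_apply, ← conv_sub_add (hasSum_norm_sq_fourierCoeff2 u).summable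
    (hasSum_norm_sq_fourierCoeff2 v).summable, ← hsub, ← hadd]
  refine (norm_conv_le (.of_hasSum (hasSum_norm_sq_fourierCoeff2 (u - v)))
    (.of_hasSum (hasSum_norm_sq_fourierCoeff2 (u + v))) ξ).trans (le_of_eq ?_)
  rw [← inv_pow, ← mul_pow, ← mul_pow, Real.sqrt_sq (by positivity), Real.sqrt_sq (by positivity)]
  ring

theorem continuous_conv_fourierCoeff2 (ξ : ℤ × ℤ) :
    Continuous fun u : L2Torus ↦ conv (fourierCoeff2 u) (fourierCoeff2 u) ξ := by
  refine continuous_iff_continuousAt.mpr fun v ↦ tendsto_iff_norm_sub_tendsto_zero.mpr <|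
    squeeze_zero (fun u ↦ norm_nonneg _) (fun u ↦ norm_conv_fourierCoeff2_sub_le u v ξ) ?_
  have hcont : Continuous fun u : L2Torus ↦
      ((2 * Real.pi) ^ 2)⁻¹ * ‖u - v‖ * ‖u + v‖ := by fun_prop
  simpa using hcont.tendsto v

theorem ofReal_sq_norm_le_sobolevSq (s : ℕ) (u : L2Torus) :
    ENNReal.ofReal (‖u‖ ^ 2) ≤ sobolevSq s u := by
  have := Real.two_pi_pos
  have h := (hasSum_norm_sq_fourierCoeff2 u).mul_left ((2 * Real.pi) ^ 2)
  rw [← mul_assoc, mul_inv_cancel₀ (by positivity), one_mul] at h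
  rw [← h.tsum_eq, ENNReal.ofReal_tsum_of_nonneg (fun ξ ↦ by positivity) h.summable]
  refine ENNReal.tsum_le_tsum fun ξ ↦ ENNReal.ofReal_le_ofReal ?_
  gcongr
  exact le_mul_of_one_le_left (sq_nonneg _) (one_le_pow₀ (by linarith [sq_nonneg (freqNorm ξ)]))

theorem sobolevSq_le_two_mul_sub_add (s : ℕ) (u v : L2Torus) :
    sobolevSq s u ≤ 2 * sobolevSq s (u - v) + 2 * sobolevSq s v := by
  have := Real.two_pi_pos
  have htwo (x : ℝ) : 2 * ENNReal.ofReal x = ENNReal.ofReal (2 * x) := by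
    rw [ENNReal.ofReal_mul zero_le_two, ENNReal.ofReal_ofNat]
  simp only [sobolevSq, ← ENNReal.tsum_mul_left, ← ENNReal.tsum_add]
  refine ENNReal.tsum_le_tsum fun ξ ↦ ?_
  rw [htwo, htwo, ← ENNReal.ofReal_add (by positivity) (by positivity)]
  refine ENNReal.ofReal_le_ofReal ?_
  have hsq : ‖fourierCoeff2 u ξ‖ ^ 2 ≤
      2 * (‖fourierCoeff2 (u - v : L2Torus) ξ‖ ^ 2 + ‖fourierCoeff2 v ξ‖ ^ 2) := by
    refine le_trans (pow_le_pow_left₀ (norm_nonneg _) ?_ 2) (add_sq_le (R := ℝ))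
    simpa only [fourierCoeff2_sub, sub_add_cancel] using
      norm_add_le (fourierCoeff2 u ξ - fourierCoeff2 v ξ) (fourierCoeff2 v ξ)
  calc _ ≤ (2 * Real.pi) ^ 2 * ((1 + freqNorm ξ ^ 2) ^ s *
        (2 * (‖fourierCoeff2 (u - v : L2Torus) ξ‖ ^ 2 + ‖fourierCoeff2 v ξ‖ ^ 2))) := by gcongr
    _ = _ := by ring

theorem sumLE_freqWeight_four_of_sobolevSq_le {u : L2Torus} {B : ℝ} (hB : 0 ≤ B)
    (h : sobolevSq 2 u ≤ ENNReal.ofReal B) :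
    SumLE (fun ξ ↦ freqWeight ξ ^ 4 * ‖fourierCoeff2 u ξ‖ ^ 2) B := by
  have hweight (ξ : ℤ × ℤ) : freqWeight ξ ^ 4 ≤ (2 * Real.pi) ^ 2 * (1 + freqNorm ξ ^ 2) ^ 2 := by
    have hsq : freqWeight ξ ^ 2 ≤ 2 * (1 + freqNorm ξ ^ 2) := by
      unfold freqWeight
      nlinarith [sq_nonneg (freqNorm ξ - 1)]
    have hfour : (4 : ℝ) ≤ (2 * Real.pi) ^ 2 := by nlinarith [Real.pi_gt_three]
    calc freqWeight ξ ^ 4 = (freqWeight ξ ^ 2) ^ 2 := by ring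
      _ ≤ (2 * (1 + freqNorm ξ ^ 2)) ^ 2 := by gcongr
      _ = 4 * (1 + freqNorm ξ ^ 2) ^ 2 := by ring
      _ ≤ _ := by gcongr
  have h0 (ξ : ℤ × ℤ) : 0 ≤ freqWeight ξ ^ 4 * ‖fourierCoeff2 u ξ‖ ^ 2 := by positivity
  have hle : ∑' ξ, ENNReal.ofReal (freqWeight ξ ^ 4 * ‖fourierCoeff2 u ξ‖ ^ 2) ≤
      ENNReal.ofReal B := by
    refine (ENNReal.tsum_le_tsum fun ξ ↦ ENNReal.ofReal_le_ofReal ?_).trans h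
    rw [← mul_assoc]
    gcongr
    exact hweight ξ
  have hs : Summable fun ξ ↦ freqWeight ξ ^ 4 * ‖fourierCoeff2 u ξ‖ ^ 2 :=
    (ENNReal.summable_toReal (ne_top_of_le_ne_top ENNReal.ofReal_ne_top hle)).congr
      fun ξ ↦ ENNReal.toReal_ofReal (h0 ξ)
  rw [← ENNReal.ofReal_tsum_of_nonneg h0 hs] at hle
  exact ⟨hs, (ENNReal.ofReal_le_ofReal_iff hB).mp hle⟩

namespace IsSolution

theorem continuousOn (h : IsSolution ε β δ η₀ η) : ContinuousOn η (Set.Ici 0) := by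
  intro t ht
  have hsq : Tendsto (fun s ↦ ENNReal.ofReal (‖η s - η t‖ ^ 2)) (𝓝[Set.Ici 0] t) (𝓝 0) :=
    tendsto_of_tendsto_of_tendsto_of_le_of_le tendsto_const_nhds (h.continuous_H2 t ht)
      (fun _ ↦ zero_le) fun s ↦ ofReal_sq_norm_le_sobolevSq 2 _
  have hreal := ((ENNReal.tendsto_toReal ENNReal.zero_ne_top).comp hsq).sqrt
  simpa [ContinuousWithinAt, tendsto_iff_norm_sub_tendsto_zero, Function.comp_def,
    Real.sqrt_sq] using hreal

theorem exists_sobolevSq_le (h : IsSolution ε β δ η₀ η) (T : ℝ) :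
    ∃ B : ℝ, 0 ≤ B ∧ ∀ t ∈ Set.Icc 0 T, sobolevSq 2 (η t) ≤ ENNReal.ofReal B := by
  refine isCompact_Icc.induction_on (p := fun S ↦
    ∃ B : ℝ, 0 ≤ B ∧ ∀ t ∈ S, sobolevSq 2 (η t) ≤ ENNReal.ofReal B) ⟨0, le_rfl, by simp⟩
    (fun s t hst ⟨B, hB, h⟩ ↦ ⟨B, hB, fun r hr ↦ h r (hst hr)⟩) ?_ fun t ht ↦ ?_
  · rintro s t ⟨B, hB, h⟩ ⟨B', -, h'⟩
    refine ⟨max B B', hB.trans (le_max_left _ _), ?_⟩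
    rintro r (hr | hr)
    · exact (h r hr).trans (ENNReal.ofReal_le_ofReal (le_max_left _ _))
    · exact (h' r hr).trans (ENNReal.ofReal_le_ofReal (le_max_right _ _))
  · have hnear : ∀ᶠ s in 𝓝[Set.Icc 0 T] t, sobolevSq 2 (η s - η t) ≤ 1 :=
      ((h.continuous_H2 t ht.1).eventually (Iic_mem_nhds zero_lt_one)).filter_mono
        (nhdsWithin_mono _ fun s hs ↦ hs.1)
    have hfin : 2 * 1 + 2 * sobolevSq 2 (η t) ≠ ⊤ :=
      ENNReal.add_ne_top.mpr ⟨by simp, ENNReal.mul_ne_top (by simp) (h.mem_H2 t ht.1).ne⟩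
    refine ⟨_, hnear, (2 * 1 + 2 * sobolevSq 2 (η t)).toReal, ENNReal.toReal_nonneg,
      fun s (hs : sobolevSq 2 (η s - η t) ≤ 1) ↦ ?_⟩
    rw [ENNReal.ofReal_toReal hfin]
    refine (sobolevSq_le_two_mul_sub_add 2 (η s) (η t)).trans ?_
    gcongr

theorem hasDerivAt_fourierCoeff2 (h : IsSolution ε β δ η₀ η) (ξ : ℤ × ℤ) {t : ℝ} (ht : 0 < t) :
    HasDerivAt (fun t ↦ fourierCoeff2 (η t) ξ) (spectralRhs (linearSymbol ε β δ)
      (fourierCoeff2 (η t)) (conv (fourierCoeff2 (η t)) (fourierCoeff2 (η t))) ξ) t := by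
  set r : ℝ → ℂ := fun t ↦ spectralRhs (linearSymbol ε β δ) (fourierCoeff2 (η t))
    (conv (fourierCoeff2 (η t)) (fourierCoeff2 (η t))) ξ
  have hr : ContinuousOn r (Set.Ici 0) :=
    (continuousOn_const.mul ((continuous_conv_fourierCoeff2 ξ).comp_continuousOn
      h.continuousOn)).add
      (continuousOn_const.mul ((continuous_fourierCoeff2 ξ).comp_continuousOn h.continuousOn))
  have hnhds : Set.Ici (0 : ℝ) ∈ 𝓝 t := Ici_mem_nhds ht
  have hd := (intervalIntegral.integral_hasDerivAt_right
    ((hr.mono Set.Icc_subset_Ici_self).intervalIntegrable_of_Icc ht.le)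
    ⟨Set.Ici 0, hnhds, hr.aestronglyMeasurable measurableSet_Ici⟩
    (hr.continuousAt hnhds)).const_add (fourierCoeff2 η₀ ξ)
  refine hd.congr_of_eventuallyEq ?_
  filter_upwards [hnhds] with s hs
  have heq := h.equation s hs ξ
  simp only [fourierCoeff2_sq] at heq
  exact heq

theorem isSpectralSolution (h : IsSolution ε β δ η₀ η) :
    IsSpectralSolution (linearSymbol ε β δ) (fun t ↦ fourierCoeff2 (η t)) := by
  refine ⟨fun T ↦ ?_, fun t ξ ↦ fourierCoeff2_neg _ _⟩
  obtain ⟨B, hB, hb⟩ := h.exists_sobolevSq_le T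
  have hη : ContinuousOn η (Set.Icc 0 T) := h.continuousOn.mono Set.Icc_subset_Ici_self
  have hB4 (t) (ht : t ∈ Set.Icc 0 T) := sumLE_freqWeight_four_of_sobolevSq_le hB (hb t ht)
  have hB3 (t) (ht : t ∈ Set.Icc 0 T) := (hB4 t ht).freqWeight_pow_mono (m := 3) (by norm_num)
  exact ⟨fun ξ ↦ (continuous_fourierCoeff2 ξ).comp_continuousOn hη,
    fun ξ ↦ (continuous_conv_fourierCoeff2 ξ).comp_continuousOn hη,
    fun ξ t ht ↦ h.hasDerivAt_fourierCoeff2 ξ ht.1, ⟨B, hB4⟩, _, fun t ht ↦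
    (hB3 t ht).freqNorm_mul_norm_conv (hB3 t ht) (hB4 t ht).sq_of_freqWeight_pow⟩

end IsSolution

end Solutions

section Energy

/-- The factor `r` in `d/dt (e ^ (2tψ) |x|²) = e ^ (2tψ) r` along `x' = spectralRhs L x Q`. -/
noncomputable def energyRate (L ψ : ℤ × ℤ → ℝ) (x Q : ℤ × ℤ → ℂ) (ξ : ℤ × ℤ) : ℝ :=
  2 * ψ ξ * ‖x ξ‖ ^ 2 + 2 * (conj (x ξ) * spectralRhs L x Q ξ).re

theorem conj_mul_spectralRhs (L : ℤ × ℤ → ℝ) (x Q : ℤ × ℤ → ℂ) (ξ : ℤ × ℤ) :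
    conj (x ξ) * spectralRhs L x Q ξ = ((L ξ * ‖x ξ‖ ^ 2 : ℝ) : ℂ) -
      Complex.I / 2 * ((ξ.1 : ℂ) * (conj (x ξ) * Q ξ)) := by
  rw [spectralRhs, Complex.ofReal_mul, Complex.ofReal_pow, ← Complex.conj_mul' (x ξ)]
  ring

theorem abs_energyRate_sub_le (L ψ : ℤ × ℤ → ℝ) (x Q : ℤ × ℤ → ℂ) (ξ : ℤ × ℤ) :
    |energyRate L ψ x Q ξ - 2 * (ψ ξ + L ξ) * ‖x ξ‖ ^ 2| ≤ freqNorm ξ * ‖x ξ‖ * ‖Q ξ‖ := by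
  have hrate : energyRate L ψ x Q ξ - 2 * (ψ ξ + L ξ) * ‖x ξ‖ ^ 2 =
      -(Complex.I * ((ξ.1 : ℂ) * (conj (x ξ) * Q ξ))).re := by
    have hhalf : Complex.I / 2 * ((ξ.1 : ℂ) * (conj (x ξ) * Q ξ)) =
        ((1 / 2 : ℝ) : ℂ) * (Complex.I * ((ξ.1 : ℂ) * (conj (x ξ) * Q ξ))) := by
      push_cast
      ring
    rw [energyRate, conj_mul_spectralRhs, Complex.sub_re, Complex.ofReal_re, hhalf,
      Complex.re_ofReal_mul]
    ring
  calc |energyRate L ψ x Q ξ - 2 * (ψ ξ + L ξ) * ‖x ξ‖ ^ 2|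
      ≤ ‖Complex.I * ((ξ.1 : ℂ) * (conj (x ξ) * Q ξ))‖ := by
        rw [hrate, abs_neg]
        exact Complex.abs_re_le_norm _
    _ = |(ξ.1 : ℝ)| * ‖x ξ‖ * ‖Q ξ‖ := by
        rw [norm_mul, norm_mul, norm_mul, RCLike.norm_conj, Complex.norm_I, Complex.norm_intCast]
        ring
    _ ≤ freqNorm ξ * ‖x ξ‖ * ‖Q ξ‖ := by gcongr; exact abs_fst_le_freqNorm ξ

theorem energyRate_le (L ψ : ℤ × ℤ → ℝ) (x Q : ℤ × ℤ → ℂ) (ξ : ℤ × ℤ) :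
    energyRate L ψ x Q ξ ≤ 2 * (ψ ξ + L ξ) * ‖x ξ‖ ^ 2 + freqNorm ξ * ‖x ξ‖ * ‖Q ξ‖ := by
  linarith [(abs_le.mp (abs_energyRate_sub_le L ψ x Q ξ)).2]

theorem hasDerivAt_exp_mul_norm_sq {z : ℝ → ℂ} {z' : ℂ} {t : ℝ} (hz : HasDerivAt z z' t)
    (a c : ℝ) : HasDerivAt (fun t ↦ Real.exp (2 * (t - a) * c) * ‖z t‖ ^ 2)
      (Real.exp (2 * (t - a) * c) * (2 * c * ‖z t‖ ^ 2 + 2 * (conj (z t) * z').re)) t := by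
  have hexp : HasDerivAt (fun t ↦ Real.exp (2 * (t - a) * c))
      (Real.exp (2 * (t - a) * c) * (2 * c)) t := by
    simpa using ((((hasDerivAt_id t).sub_const a).const_mul 2).mul_const c).exp
  have hsq : HasDerivAt (fun t ↦ ‖z t‖ ^ 2) (2 * (conj (z t) * z').re) t := by
    simpa only [real_inner_eq_re_inner ℂ, RCLike.inner_apply, mul_comm z'] using! hz.norm_sq
  exact (hexp.mul hsq).congr_deriv (by ring)

namespace IsBiharmonicSymbol

variable {ε : ℝ} {L ψ : ℤ × ℤ → ℝ} {n : ℝ}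

theorem exists_abs_energyRate_le (hL : IsBiharmonicSymbol ε L) (hψ : ∀ ξ, |ψ ξ| ≤ n) :
    ∃ M, 0 ≤ M ∧ ∀ (x Q : ℤ × ℤ → ℂ) (ξ : ℤ × ℤ), |energyRate L ψ x Q ξ| ≤
      M * (freqWeight ξ ^ 4 * ‖x ξ‖ ^ 2) + freqNorm ξ * ‖x ξ‖ * ‖Q ξ‖ := by
  obtain ⟨M, hM, hLM⟩ := hL.exists_abs_le
  have hn : 0 ≤ n := (abs_nonneg _).trans (hψ 0)
  refine ⟨2 * (n + M), by positivity, fun x Q ξ ↦ ?_⟩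
  have hψL : |ψ ξ + L ξ| ≤ (n + M) * freqWeight ξ ^ 4 :=
    calc |ψ ξ + L ξ| ≤ n + M * freqWeight ξ ^ 4 :=
          (abs_add_le _ _).trans (add_le_add (hψ ξ) (hLM ξ))
      _ ≤ n * freqWeight ξ ^ 4 + M * freqWeight ξ ^ 4 := by
          gcongr
          exact le_mul_of_one_le_right hn (one_le_pow₀ (one_le_freqWeight ξ))
      _ = (n + M) * freqWeight ξ ^ 4 := by ring
  have hmain : |2 * (ψ ξ + L ξ) * ‖x ξ‖ ^ 2| ≤ 2 * (n + M) * (freqWeight ξ ^ 4 * ‖x ξ‖ ^ 2) := by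
    rw [abs_mul, abs_mul, abs_two, abs_of_nonneg (sq_nonneg ‖x ξ‖)]
    calc 2 * |ψ ξ + L ξ| * ‖x ξ‖ ^ 2 ≤ 2 * ((n + M) * freqWeight ξ ^ 4) * ‖x ξ‖ ^ 2 := by gcongr
      _ = _ := by ring
  calc |energyRate L ψ x Q ξ|
      ≤ |2 * (ψ ξ + L ξ) * ‖x ξ‖ ^ 2| + |energyRate L ψ x Q ξ - 2 * (ψ ξ + L ξ) * ‖x ξ‖ ^ 2| := by
        linarith [abs_sub_abs_le_abs_sub (energyRate L ψ x Q ξ) (2 * (ψ ξ + L ξ) * ‖x ξ‖ ^ 2)]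
    _ ≤ _ := add_le_add hmain (abs_energyRate_sub_le L ψ x Q ξ)

theorem tsum_sq_mul_energyRate_le (hL : IsBiharmonicSymbol ε L) (hψ : ∀ ξ, |ψ ξ| ≤ n)
    {w c : ℤ × ℤ → ℝ} {x Q : ℤ × ℤ → ℂ} {B P K : ℝ} (hw : ∀ ξ, 0 ≤ w ξ)
    (hx : SumLE (fun ξ ↦ freqWeight ξ ^ 4 * (w ξ * ‖x ξ‖) ^ 2) B)
    (hQ : ∀ ξ, w ξ * ‖Q ξ‖ ≤ c ξ)
    (hc : SumLE (fun ξ ↦ freqNorm ξ * (w ξ * ‖x ξ‖) * c ξ)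
      (P * ∑' ξ, freqWeight ξ ^ 3 * (w ξ * ‖x ξ‖) ^ 2))
    (hK : ∀ ξ, ψ ξ + L ξ + P / 2 * freqWeight ξ ^ 3 ≤ K) :
    ∑' ξ, w ξ ^ 2 * energyRate L ψ x Q ξ ≤ 2 * K * ∑' ξ, (w ξ * ‖x ξ‖) ^ 2 := by
  obtain ⟨M, _, hrate⟩ := hL.exists_abs_energyRate_le hψ
  have h3 := (hx.freqWeight_pow_mono (m := 3) (by norm_num)).summable
  have h0 := hx.sq_of_freqWeight_pow.summable
  have hforce (ξ : ℤ × ℤ) : w ξ ^ 2 * (freqNorm ξ * ‖x ξ‖ * ‖Q ξ‖) ≤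
      freqNorm ξ * (w ξ * ‖x ξ‖) * c ξ := by
    have := hw ξ
    have := freqNorm_nonneg ξ
    calc _ = freqNorm ξ * (w ξ * ‖x ξ‖) * (w ξ * ‖Q ξ‖) := by ring
      _ ≤ _ := by gcongr; exact hQ ξ
  have hsum : Summable fun ξ ↦ w ξ ^ 2 * energyRate L ψ x Q ξ := by
    refine ((hx.summable.mul_left M).add hc.summable).of_norm_bounded fun ξ ↦ ?_
    rw [Real.norm_eq_abs, abs_mul, abs_of_nonneg (sq_nonneg (w ξ))]
    have := mul_le_mul_of_nonneg_left (hrate x Q ξ) (sq_nonneg (w ξ))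
    linarith [hforce ξ]
  have hle (ξ : ℤ × ℤ) : w ξ ^ 2 * energyRate L ψ x Q ξ ≤ 2 * K * (w ξ * ‖x ξ‖) ^ 2 -
      P * (freqWeight ξ ^ 3 * (w ξ * ‖x ξ‖) ^ 2) + freqNorm ξ * (w ξ * ‖x ξ‖) * c ξ := by
    have h1 := mul_le_mul_of_nonneg_left (energyRate_le L ψ x Q ξ) (sq_nonneg (w ξ))
    have h2 := mul_le_mul_of_nonneg_right (hK ξ) (sq_nonneg (w ξ * ‖x ξ‖))
    linarith [hforce ξ]
  have hmain := (h0.mul_left (2 * K)).sub (h3.mul_left P)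
  refine (hsum.tsum_le_tsum hle (hmain.add hc.summable)).trans ?_
  rw [hmain.tsum_add hc.summable, (h0.mul_left _).tsum_sub (h3.mul_left _), tsum_mul_left,
    tsum_mul_left]
  linarith [hc.tsum_le]

theorem tsum_energyRate_conv_le (hL : IsBiharmonicSymbol ε L) (hψ : ∀ ξ, |ψ ξ| ≤ n)
    {x d : ℤ × ℤ → ℂ} {B D K : ℝ} (hx : SumLE (fun ξ ↦ freqWeight ξ ^ 4 * ‖x ξ‖ ^ 2) B)
    (hd : SumLE (fun ξ ↦ freqWeight ξ ^ 3 * ‖d ξ‖ ^ 2) D)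
    (hK : ∀ ξ, ψ ξ + L ξ + √weightConst * √D / 2 * freqWeight ξ ^ 3 ≤ K) :
    ∑' ξ, energyRate L ψ x (conv d x) ξ ≤ 2 * K * ∑' ξ, ‖x ξ‖ ^ 2 := by
  have hx3 := SumLE.of_hasSum (hx.freqWeight_pow_mono (m := 3) (by norm_num)).summable.hasSum
  have hforce := hx3.freqNorm_mul_norm_conv hd hx3.sq_of_freqWeight_pow
  rw [Real.mul_self_sqrt (tsum_nonneg fun ξ ↦ by have := freqWeight_pos ξ; positivity),
    mul_comm] at hforce
  simpa only [one_pow, one_mul] using hL.tsum_sq_mul_energyRate_le hψ (w := fun _ ↦ 1)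
    (fun _ ↦ zero_le_one) (by simpa only [one_mul] using hx) (fun ξ ↦ (one_mul _).le)
    (by simpa only [one_mul] using hforce) hK

end IsBiharmonicSymbol

theorem IsSpectralFlow.isPrimitiveOn_energy {ε n a b : ℝ} {L ψ : ℤ × ℤ → ℝ}
    {x Q : ℝ → ℤ × ℤ → ℂ} (h : IsSpectralFlow L x Q a b) (hL : IsBiharmonicSymbol ε L)
    (hψ : ∀ ξ, |ψ ξ| ≤ n) (hab : a ≤ b) :
    IsPrimitiveOn (fun t ↦ ∑' ξ, Real.exp (2 * (t - a) * ψ ξ) * ‖x t ξ‖ ^ 2)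
      (fun t ↦ ∑' ξ, Real.exp (2 * (t - a) * ψ ξ) * energyRate L ψ (x t) (Q t) ξ) a b := by
  obtain ⟨M, hM, hrate⟩ := hL.exists_abs_energyRate_le hψ
  obtain ⟨B, hB⟩ := h.bounded
  obtain ⟨D, hD⟩ := h.bounded_force
  set E := Real.exp (2 * (b - a) * n)
  have hexp : ∀ t ∈ Set.Icc a b, ∀ ξ, Real.exp (2 * (t - a) * ψ ξ) ≤ E := fun t ht ξ ↦ by
    have := sub_nonneg.mpr ht.1
    have hn : 0 ≤ n := (abs_nonneg _).trans (hψ 0)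
    have := (le_abs_self _).trans (hψ ξ)
    refine Real.exp_le_exp.mpr ?_
    calc 2 * (t - a) * ψ ξ ≤ 2 * (t - a) * n := by gcongr
      _ ≤ 2 * (b - a) * n := by gcongr; exact ht.2
  refine IsPrimitiveOn.tsum (B := E * (M * B + D)) hab
    (fun ξ ↦ .of_hasDerivAt hab ?_ ?_ fun t ht ↦
      hasDerivAt_exp_mul_norm_sq (h.hasDerivAt ξ t ht) a _)
    (fun t ht ↦ ?_) fun t ht ↦ ?_
  · exact (by fun_prop : Continuous fun t ↦ Real.exp (2 * (t - a) * ψ ξ)).continuousOn.mul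
      ((h.continuousOn ξ).norm.pow 2)
  · refine (by fun_prop : Continuous fun t ↦ Real.exp (2 * (t - a) * ψ ξ)).continuousOn.mul
      ((continuousOn_const.mul ((h.continuousOn ξ).norm.pow 2)).add (continuousOn_const.mul ?_))
    exact Complex.continuous_re.comp_continuousOn
      ((Complex.continuous_conj.comp_continuousOn (h.continuousOn ξ)).mul
        (h.continuousOn_spectralRhs ξ))
  · refine ((hB t ht).sq_of_freqWeight_pow.summable.mul_left E).of_nonneg_of_le
      (fun ξ ↦ by positivity) fun ξ ↦ ?_
    gcongr ?_ * _
    exact hexp t ht ξ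
  · refine ((((hB t ht).const_mul hM).add (hD t ht)).const_mul (Real.exp_pos _).le).of_le
      (fun ξ ↦ abs_nonneg _) fun ξ ↦ ?_
    rw [abs_mul, abs_of_pos (Real.exp_pos _)]
    exact mul_le_mul (hexp t ht ξ) (hrate _ _ ξ) (abs_nonneg _) (Real.exp_pos _).le

end Energy

section Oddness

theorem SumLE.freqWeight_pow_norm_add {n : ℕ} {x y : ℤ × ℤ → ℂ} {A B : ℝ}
    (hx : SumLE (fun ξ ↦ freqWeight ξ ^ n * ‖x ξ‖ ^ 2) A)
    (hy : SumLE (fun ξ ↦ freqWeight ξ ^ n * ‖y ξ‖ ^ 2) B) :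
    SumLE (fun ξ ↦ freqWeight ξ ^ n * ‖(x + y) ξ‖ ^ 2) (2 * (A + B)) := by
  refine ((hx.add hy).const_mul zero_le_two).of_le
    (fun ξ ↦ by have := freqWeight_pos ξ; positivity) fun ξ ↦ ?_
  have hW := pow_nonneg (freqWeight_pos ξ).le n
  calc freqWeight ξ ^ n * ‖x ξ + y ξ‖ ^ 2 ≤ freqWeight ξ ^ n * (‖x ξ‖ + ‖y ξ‖) ^ 2 := by
        gcongr
        exact norm_add_le _ _
    _ ≤ freqWeight ξ ^ n * (2 * (‖x ξ‖ ^ 2 + ‖y ξ‖ ^ 2)) := by gcongr; exact add_sq_le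
    _ = _ := by ring

theorem SumLE.freqWeight_pow_norm_sub {n : ℕ} {x y : ℤ × ℤ → ℂ} {A B : ℝ}
    (hx : SumLE (fun ξ ↦ freqWeight ξ ^ n * ‖x ξ‖ ^ 2) A)
    (hy : SumLE (fun ξ ↦ freqWeight ξ ^ n * ‖y ξ‖ ^ 2) B) :
    SumLE (fun ξ ↦ freqWeight ξ ^ n * ‖(x - y) ξ‖ ^ 2) (2 * (A + B)) := by
  rw [sub_eq_add_neg]
  exact hx.freqWeight_pow_norm_add (by simpa only [Pi.neg_apply, norm_neg] using hy)

theorem SumLE.freqWeight_pow_comp_reflectFst {n : ℕ} {x : ℤ × ℤ → ℂ} {A : ℝ}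
    (hx : SumLE (fun ξ ↦ freqWeight ξ ^ n * ‖x ξ‖ ^ 2) A) :
    SumLE (fun ξ ↦ freqWeight ξ ^ n * ‖(x ∘ reflectFst) ξ‖ ^ 2) A := by
  simpa only [AddEquiv.toEquiv_eq_coe, AddEquiv.coe_toEquiv, freqWeight_reflectFst] using!
    hx.comp_equiv reflectFst.toEquiv

/-- The sign of the force flips because `∂ₓ` is odd. -/
theorem spectralRhs_add_reflectFst {L : ℤ × ℤ → ℝ} (hL : ∀ ξ, L (reflectFst ξ) = L ξ)
    (x Q : ℤ × ℤ → ℂ) (ξ : ℤ × ℤ) :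
    spectralRhs L x Q ξ + spectralRhs L x Q (reflectFst ξ) =
      spectralRhs L (x + x ∘ reflectFst) (Q - Q ∘ reflectFst) ξ := by
  simp only [spectralRhs, hL, Pi.add_apply, Pi.sub_apply, Function.comp_apply]
  rw [reflectFst_apply, Int.cast_neg]
  ring

namespace IsSpectralSolution

variable {ε : ℝ} {L : ℤ × ℤ → ℝ} {a : ℝ → ℤ × ℤ → ℂ}

theorem isSpectralFlow_add_reflectFst (h : IsSpectralSolution L a)
    (hL : ∀ ξ, L (reflectFst ξ) = L ξ) (T : ℝ) :
    IsSpectralFlow L (fun t ↦ a t + a t ∘ reflectFst)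
      (fun t ↦ conv (a t - a t ∘ reflectFst) (a t + a t ∘ reflectFst)) 0 T := by
  have hflow := h.isSpectralFlow T
  obtain ⟨B, hB⟩ := hflow.bounded
  have hforce : ∀ t ∈ Set.Icc 0 T, conv (a t - a t ∘ reflectFst) (a t + a t ∘ reflectFst) =
      conv (a t) (a t) - conv (a t) (a t) ∘ reflectFst := fun t ht ↦ by
    rw [conv_sub_add (hB t ht).sq_of_freqWeight_pow.summable
      (hB t ht).freqWeight_pow_comp_reflectFst.sq_of_freqWeight_pow.summable, conv_comp_addEquiv]
  refine ⟨fun ξ ↦ (hflow.continuousOn ξ).add (hflow.continuousOn (reflectFst ξ)),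
    fun ξ ↦ ((hflow.continuousOn_force ξ).sub (hflow.continuousOn_force (reflectFst ξ))).congr
      fun t ht ↦ congrFun (hforce t ht) ξ, fun ξ t ht ↦ ?_,
    ⟨2 * (B + B), fun t ht ↦
      (hB t ht).freqWeight_pow_norm_add (hB t ht).freqWeight_pow_comp_reflectFst⟩,
    ⟨√(2 * (B + B)) * √(2 * (B + B)) * (√weightConst * √(2 * (B + B))), fun t ht ↦ ?_⟩⟩
  · rw [hforce t ⟨ht.1.le, ht.2.le⟩, ← spectralRhs_add_reflectFst hL]
    exact (hflow.hasDerivAt ξ t ht).add (hflow.hasDerivAt (reflectFst ξ) t ht)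
  · have hadd := (hB t ht).freqWeight_pow_norm_add (hB t ht).freqWeight_pow_comp_reflectFst
    have hsub := (hB t ht).freqWeight_pow_norm_sub (hB t ht).freqWeight_pow_comp_reflectFst
    exact SumLE.freqNorm_mul_norm_conv (hadd.freqWeight_pow_mono (by norm_num))
      (hsub.freqWeight_pow_mono (by norm_num)) hadd.sq_of_freqWeight_pow

theorem odd (h : IsSpectralSolution L a) (hL : IsBiharmonicSymbol ε L)
    (h0 : ∀ ξ, a 0 (reflectFst ξ) = -a 0 ξ) {t : ℝ} (ht : 0 ≤ t) (ξ : ℤ × ℤ) :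
    a t (reflectFst ξ) = -a t ξ := by
  obtain ⟨B, hB⟩ := (h.isSpectralFlow t).bounded
  have hflow := h.isSpectralFlow_add_reflectFst hL.even_fst t
  obtain ⟨B', hB'⟩ := hflow.bounded
  set D := √weightConst * √(2 * (B + B))
  obtain ⟨K, _, hKL⟩ := hL.exists_add_cube_le (D / 2)
  have hKD (ξ : ℤ × ℤ) : -K + L ξ + D / 2 * freqWeight ξ ^ 3 ≤ 0 := by
    have := hL.pos
    linarith [hKL ξ, show 0 ≤ ε / 2 * freqNorm ξ ^ 4 by positivity]
  -- The weight `e ^ (-2tK)` makes the energy of the even part nonincreasing.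
  have hprim := hflow.isPrimitiveOn_energy (ψ := fun _ ↦ -K) hL (fun _ ↦ le_rfl) ht
  have hzero := hprim.le_of_nonpos_above (M := 0) (t := t) (by simp [h0, -reflectFst_apply])
    (fun s hs _ ↦ ?_) ⟨ht, le_rfl⟩
  · rw [tsum_mul_left] at hzero
    have hsum := nonpos_of_mul_nonpos_right hzero (Real.exp_pos _)
    have hterm := (hB' t ⟨ht, le_rfl⟩).sq_of_freqWeight_pow.summable.le_tsum ξ
      fun _ _ ↦ sq_nonneg _
    have hnorm := pow_eq_zero_iff two_ne_zero |>.mp ((hterm.trans hsum).antisymm (sq_nonneg _))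
    exact eq_neg_of_add_eq_zero_right (norm_eq_zero.mp hnorm)
  · rw [tsum_mul_left]
    have hsub := (hB s hs).freqWeight_pow_norm_sub (hB s hs).freqWeight_pow_comp_reflectFst
    have hrate := hL.tsum_energyRate_conv_le (ψ := fun _ ↦ -K) (fun _ ↦ le_rfl) (hB' s hs)
      (hsub.freqWeight_pow_mono (by norm_num)) hKD
    refine mul_nonpos_of_nonneg_of_nonpos (Real.exp_pos _).le ?_
    simpa only [mul_zero, zero_mul] using hrate

end IsSpectralSolution

end Oddness

section EnergyBalance

theorem conv_self_zero {a : ℤ × ℤ → ℂ} (hneg : ∀ ξ, a (-ξ) = conj (a ξ)) :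
    conv a a 0 = ((∑' ξ, ‖a ξ‖ ^ 2 : ℝ) : ℂ) := by
  rw [conv, Complex.ofReal_tsum]
  refine tsum_congr fun ξ ↦ ?_
  rw [zero_sub, hneg, Complex.mul_conj', Complex.ofReal_pow]

theorem summable_fst_mul_triple {a b c : ℤ × ℤ → ℂ} {A B C : ℝ}
    (ha : SumLE (fun ξ ↦ freqWeight ξ ^ 3 * ‖a ξ‖ ^ 2) A)
    (hb : SumLE (fun ξ ↦ freqWeight ξ ^ 3 * ‖b ξ‖ ^ 2) B) (hc : SumLE (fun ξ ↦ ‖c ξ‖ ^ 2) C) :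
    Summable fun p : (ℤ × ℤ) × (ℤ × ℤ) ↦ (p.1.1 : ℂ) * (a p.1 * (b p.2 * c (p.1 - p.2))) := by
  have hfiber (ξ : ℤ × ℤ) := SumLE.of_hasSum
    (hb.sq_of_freqWeight_pow.conv_apply hc ξ).summable.hasSum
  have hrow (ξ : ℤ × ℤ) := (hfiber ξ).const_mul
    (mul_nonneg (freqNorm_nonneg ξ) (norm_nonneg (a ξ)))
  have htriple := SumLE.freqNorm_mul_conv (fun _ ↦ norm_nonneg _) (fun _ ↦ norm_nonneg _)
    (fun _ ↦ norm_nonneg _) ha hb.of_freqWeight_cube hc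
  refine (SumLE.prod_of_nonneg (F := fun p : (ℤ × ℤ) × (ℤ × ℤ) ↦
    freqNorm p.1 * ‖a p.1‖ * (‖b p.2‖ * ‖c (p.1 - p.2)‖))
    (fun p ↦ by have := freqNorm_nonneg p.1; positivity) hrow htriple).summable.of_norm_bounded
    fun p ↦ ?_
  rw [norm_mul, norm_mul, norm_mul, Complex.norm_intCast, ← mul_assoc]
  gcongr
  exact abs_fst_le_freqNorm p.1

theorem tsum_eq_zero_of_add_comp_equiv {ι M : Type*} [AddCommGroup M] [TopologicalSpace M]
    [IsTopologicalAddGroup M] [T2Space M] [IsAddTorsionFree M] {F : ι → M} (hF : Summable F)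
    (σ τ : ι ≃ ι) (h : ∀ p, F p + F (σ p) + F (τ p) = 0) : ∑' p, F p = 0 := by
  have hFσ : Summable fun p ↦ F (σ p) := σ.summable_iff.mpr hF
  have hFτ : Summable fun p ↦ F (τ p) := τ.summable_iff.mpr hF
  have hsum : ∑' p, (F p + F (σ p) + F (τ p)) = 3 • ∑' p, F p := by
    rw [(hF.add hFσ).tsum_add hFτ, hF.tsum_add hFσ, σ.tsum_eq F, τ.tsum_eq F]
    abel
  simp only [h, tsum_zero] at hsum
  exact (smul_eq_zero_iff_right three_ne_zero).mp hsum.symm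

/-- The product `a (-ξ) * (a ζ * a (ξ - ζ))` is symmetric in its three frequencies. As these add up
to zero, averaging over the frequency that carries the derivative gives zero. -/
theorem hasSum_fst_mul_conj_mul_conv {a : ℤ × ℤ → ℂ} {A : ℝ} (hneg : ∀ ξ, a (-ξ) = conj (a ξ))
    (ha : SumLE (fun ξ ↦ freqWeight ξ ^ 3 * ‖a ξ‖ ^ 2) A) :
    HasSum (fun ξ : ℤ × ℤ ↦ (ξ.1 : ℂ) * (conj (a ξ) * conv a a ξ)) 0 := by
  have hF := summable_fst_mul_triple (a := fun ξ ↦ conj (a ξ))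
    (by simpa only [RCLike.norm_conj] using ha) ha ha.sq_of_freqWeight_pow
  have hzero := tsum_eq_zero_of_add_comp_equiv hF
    ⟨fun p ↦ (-p.2, -p.1), fun p ↦ (-p.2, -p.1), fun p ↦ by simp, fun p ↦ by simp⟩
    ⟨fun p ↦ (p.2 - p.1, p.2), fun p ↦ (p.2 - p.1, p.2), fun p ↦ by simp, fun p ↦ by simp⟩
    fun p ↦ by
      simp only [Equiv.coe_fn_mk, ← hneg, neg_neg, neg_sub_neg, neg_sub, sub_sub_cancel_left,
        Prod.fst_neg, Prod.fst_sub]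
      push_cast
      ring
  have hfull := hF.hasSum
  rw [hzero] at hfull
  have h2 := ha.sq_of_freqWeight_pow.summable
  exact hfull.prod_fiberwise fun ξ ↦
    ((summable_conv_apply h2 h2 ξ).hasSum.mul_left (conj (a ξ))).mul_left (ξ.1 : ℂ)

theorem IsBiharmonicSymbol.summable_mul_norm_sq {ε B : ℝ} {L : ℤ × ℤ → ℝ} {a : ℤ × ℤ → ℂ}
    (hL : IsBiharmonicSymbol ε L) (ha : SumLE (fun ξ ↦ freqWeight ξ ^ 4 * ‖a ξ‖ ^ 2) B) :
    Summable fun ξ ↦ L ξ * ‖a ξ‖ ^ 2 := by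
  obtain ⟨M, -, hM⟩ := hL.exists_abs_le
  refine (ha.summable.mul_left M).of_norm_bounded fun ξ ↦ ?_
  rw [norm_mul, Real.norm_eq_abs, Real.norm_of_nonneg (sq_nonneg ‖a ξ‖), ← mul_assoc]
  gcongr
  exact hM ξ

theorem IsBiharmonicSymbol.tsum_energyRate_conv_self {ε B : ℝ} {L : ℤ × ℤ → ℝ}
    {a : ℤ × ℤ → ℂ} (hL : IsBiharmonicSymbol ε L) (hneg : ∀ ξ, a (-ξ) = conj (a ξ))
    (ha : SumLE (fun ξ ↦ freqWeight ξ ^ 4 * ‖a ξ‖ ^ 2) B) :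
    ∑' ξ, energyRate L 0 a (conv a a) ξ = 2 * ∑' ξ, L ξ * ‖a ξ‖ ^ 2 := by
  have hlin := Complex.hasSum_ofReal.mpr (hL.summable_mul_norm_sq ha).hasSum
  have hforce := (hasSum_fst_mul_conj_mul_conv hneg
    (ha.freqWeight_pow_mono (by norm_num))).mul_left (Complex.I / 2)
  have hre := (Complex.hasSum_re (hlin.sub hforce)).mul_left 2
  rw [mul_zero, sub_zero, Complex.ofReal_re] at hre
  rw [← hre.tsum_eq]
  refine tsum_congr fun ξ ↦ ?_
  rw [energyRate, conj_mul_spectralRhs, Pi.zero_apply, mul_zero, zero_mul, zero_add]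

theorem IsBiharmonicSymbol.exists_tsum_energyRate_conv_self_le {ε : ℝ} {L : ℤ × ℤ → ℝ}
    (hL : IsBiharmonicSymbol ε L) :
    ∃ A, 0 ≤ A ∧ ∀ (a : ℤ × ℤ → ℂ) (B : ℝ), (∀ ξ, a (-ξ) = conj (a ξ)) →
      SumLE (fun ξ ↦ freqWeight ξ ^ 4 * ‖a ξ‖ ^ 2) B →
      ∑' ξ, energyRate L 0 a (conv a a) ξ ≤
        A * ∑' ξ, ‖a ξ‖ ^ 2 - ε * ∑' ξ, freqNorm ξ ^ 4 * ‖a ξ‖ ^ 2 := by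
  obtain ⟨K, hK, hLK⟩ := hL.exists_add_cube_le 0
  refine ⟨2 * K, by positivity, fun a B hneg ha ↦ ?_⟩
  have h2 := ha.sq_of_freqWeight_pow.summable
  have h4 := ha.freqNorm_pow.summable
  rw [hL.tsum_energyRate_conv_self hneg ha, ← tsum_mul_left, ← tsum_mul_left, ← tsum_mul_left,
    ← (h2.mul_left _).tsum_sub (h4.mul_left _)]
  refine ((hL.summable_mul_norm_sq ha).mul_left 2).tsum_le_tsum (fun ξ ↦ ?_)
    ((h2.mul_left _).sub (h4.mul_left _))
  have := mul_le_mul_of_nonneg_right (hLK ξ) (sq_nonneg ‖a ξ‖)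
  linarith

end EnergyBalance

section LowModes

theorem exists_sumLE_indicator_lt {ι : Type*} {f : ι → ℝ} (hf : Summable f) (hf0 : ∀ i, 0 ≤ f i)
    (N : ι → ℤ) {κ : ℝ} (hκ : 0 < κ) :
    ∃ n : ℤ, 0 ≤ n ∧ SumLE ({i | n < N i}.indicator f) κ := by
  obtain ⟨s, hs⟩ := summable_iff_vanishing_norm.mp hf κ hκ
  refine ⟨∑ i ∈ s, |N i|, Finset.sum_nonneg fun i _ ↦ abs_nonneg _,
    .of_sum_le (fun i ↦ Set.indicator_nonneg (fun i _ ↦ hf0 i) i) fun t ↦ ?_⟩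
  classical
  rw [Finset.sum_indicator_eq_sum_filter]
  refine (le_abs_self _).trans (hs _ (Finset.disjoint_left.mpr fun i hi his ↦ ?_)).le
  have hle := Finset.single_le_sum (f := fun i ↦ |N i|) (fun i _ ↦ abs_nonneg _) his
  exact ((Finset.mem_filter.mp hi).2.trans_le (le_abs_self _)).not_ge hle

theorem SumLE.comp_injective {ι κ : Type*} {f : ι → ℝ} {B : ℝ} (hf : SumLE f B)
    (hf0 : ∀ i, 0 ≤ f i) {e : κ → ι} (he : Function.Injective e) : SumLE (fun k ↦ f (e k)) B :=
  ⟨hf.summable.comp_injective he, (tsum_comp_le_tsum_of_inj hf.summable hf0 he).trans hf.tsum_le⟩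

theorem SumLE.mul_add_of_prod {ι κ : Type*} {T : ι × ι → ℝ} {h : ι × κ → ℝ} {A B : ℝ}
    (hT0 : ∀ p, 0 ≤ T p) (hh0 : ∀ p, 0 ≤ h p) (hT : SumLE T A) (hh : SumLE h B) :
    SumLE (fun p : (ι × κ) × ι ↦ T (p.1.1, p.2) * (h p.1 + h (p.2, p.1.2)))
      (2 * B * A) := by
  have hfiber (i : ι) : SumLE (fun k ↦ h (i, k)) B :=
    hh.comp_injective hh0 (Prod.mk_right_injective i)
  have hpairs : SumLE (fun p : (ι × ι) × κ ↦ T p.1 * (h (p.1.1, p.2) + h (p.1.2, p.2)))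
      (2 * B * A) := by
    refine .prod_of_nonneg (fun p ↦ mul_nonneg (hT0 _) (add_nonneg (hh0 _) (hh0 _)))
      (fun p ↦ ((hfiber p.1).add (hfiber p.2)).const_mul (hT0 p)) ?_
    have hB := hh.nonneg hh0
    simpa only [mul_comm _ (B + B), two_mul] using hT.const_mul (add_nonneg hB hB)
  exact hpairs.comp_equiv (((Equiv.prodAssoc ι κ ι).trans
    ((Equiv.refl ι).prodCongr (Equiv.prodComm κ ι))).trans (Equiv.prodAssoc ι ι κ).symm)

theorem sum_Icc_shift_of_odd {M : Type*} [AddCommGroup M] [IsAddTorsionFree M] {b : ℤ → M}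
    (hb : ∀ n, b (-n) = -b n) (N m : ℤ) :
    ∑ k ∈ Finset.Icc (-N) N, b (k - m) =
      ∑ n ∈ (Finset.Icc (-N - m) (N - m)).filter (fun n ↦ N < |m| + |n|), b n := by
  have hshift : ∑ k ∈ Finset.Icc (-N) N, b (k - m) = ∑ n ∈ Finset.Icc (-N - m) (N - m), b n := by
    refine Finset.sum_bij' (fun k _ ↦ k - m) (fun n _ ↦ n + m) ?_ ?_ ?_ ?_ ?_ <;> (simp; try omega)
  rw [hshift, ← Finset.sum_filter_add_sum_filter_not _ (fun n ↦ N < |m| + |n|), add_eq_left]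
  refine Finset.sum_involution (fun n _ ↦ -n) (fun n _ ↦ by rw [hb, add_neg_cancel])
    (fun n _ hn hfix ↦ hn (self_eq_neg.mp ((congrArg b hfix).symm.trans (hb n)))) (fun n hn ↦ ?_)
    fun n _ ↦ neg_neg n
  simp only [Finset.mem_filter, Finset.mem_Icc, abs_neg] at hn ⊢
  rcases abs_cases m with h | h <;> rcases abs_cases n with h' | h' <;> omega

/-- The weight `(m n)⁻²` on pairs of integers, zero on the axes. -/
noncomputable def invSqWeight (p : ℤ × ℤ) : ℝ := ((p.1 : ℝ) ^ 2)⁻¹ * ((p.2 : ℝ) ^ 2)⁻¹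

theorem invSqWeight_nonneg (p : ℤ × ℤ) : 0 ≤ invSqWeight p := by unfold invSqWeight; positivity

theorem summable_invSqWeight : Summable invSqWeight := by
  have h : Summable fun n : ℤ ↦ ((n : ℝ) ^ 2)⁻¹ := by
    simpa using Real.summable_one_div_int_pow.mpr one_lt_two
  exact h.mul_of_nonneg h (fun m ↦ by positivity) (fun m ↦ by positivity)

theorem two_mul_le_invSqWeight_mul (p : ℤ × ℤ) {x y : ℝ} (hx : p.1 = 0 → x = 0)
    (hy : p.2 = 0 → y = 0) :
    2 * (x * y) ≤ invSqWeight p * ((p.1 : ℝ) ^ 4 * x ^ 2 + (p.2 : ℝ) ^ 4 * y ^ 2) := by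
  rcases eq_or_ne p.1 0 with h1 | h1
  · simp [invSqWeight, h1, hx h1]
  rcases eq_or_ne p.2 0 with h2 | h2
  · simp [invSqWeight, h2, hy h2]
  rw [invSqWeight, ← mul_inv, inv_mul_eq_div, le_div_iff₀ (by positivity)]
  nlinarith [sq_nonneg ((p.1 : ℝ) ^ 2 * x - (p.2 : ℝ) ^ 2 * y)]

/-- The function with Fourier coefficients `a` is real and odd in the first variable. -/
structure IsOddSpectrum (a : ℤ × ℤ → ℂ) : Prop where
  neg : ∀ ξ, a (-ξ) = conj (a ξ)
  odd : ∀ ξ, a (reflectFst ξ) = -a ξ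

namespace IsOddSpectrum

variable {a : ℤ × ℤ → ℂ}

theorem zero_left (h : IsOddSpectrum a) (l : ℤ) : a (0, l) = 0 :=
  self_eq_neg.mp (by simpa using h.odd (0, l))

theorem norm_neg_right (h : IsOddSpectrum a) (m l : ℤ) : ‖a (m, -l)‖ = ‖a (m, l)‖ := by
  have hneg : a (-m, -l) = conj (a (m, l)) := h.neg (m, l)
  have hodd : a (-m, -l) = -a (m, -l) := h.odd (m, -l)
  rw [← norm_neg, ← hodd, hneg, RCLike.norm_conj]

/-- By oddness, the `k`-sum only sees the modes `n = k - m` with `N < |m| + |n|`. -/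
theorem two_mul_norm_sum_mul_le (h : IsOddSpectrum a) (N m l : ℤ)
    (hsum : Summable fun n : ℤ ↦ {p : ℤ × ℤ | N < |p.1| + |p.2|}.indicator invSqWeight (m, n) *
      ((m : ℝ) ^ 4 * ‖a (m, l)‖ ^ 2 + (n : ℝ) ^ 4 * ‖a (n, l)‖ ^ 2)) :
    2 * ‖∑ k ∈ Finset.Icc (-N) N, a (m, l) * a ((k, 0) - (m, l))‖ ≤
      ∑' n : ℤ, {p : ℤ × ℤ | N < |p.1| + |p.2|}.indicator invSqWeight (m, n) *
        ((m : ℝ) ^ 4 * ‖a (m, l)‖ ^ 2 + (n : ℝ) ^ 4 * ‖a (n, l)‖ ^ 2) := by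
  set s := (Finset.Icc (-N - m) (N - m)).filter (fun n ↦ N < |m| + |n|)
  have hshift : ∑ k ∈ Finset.Icc (-N) N, a (m, l) * a ((k, 0) - (m, l)) =
      ∑ n ∈ s, a (m, l) * a (n, -l) := by
    rw [← Finset.mul_sum, ← Finset.mul_sum,
      ← sum_Icc_shift_of_odd (b := fun n ↦ a (n, -l)) (fun n ↦ h.odd (n, -l))]
    simp only [Prod.mk_sub_mk, zero_sub]
  calc 2 * ‖∑ k ∈ Finset.Icc (-N) N, a (m, l) * a ((k, 0) - (m, l))‖
      ≤ ∑ n ∈ s, 2 * (‖a (m, l)‖ * ‖a (n, l)‖) := by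
        rw [hshift, ← Finset.mul_sum s _ (2 : ℝ)]
        refine mul_le_mul_of_nonneg_left ?_ (zero_le_two (α := ℝ))
        simpa only [norm_mul, h.norm_neg_right] using norm_sum_le s fun n ↦ a (m, l) * a (n, -l)
    _ ≤ ∑ n ∈ s, {p : ℤ × ℤ | N < |p.1| + |p.2|}.indicator invSqWeight (m, n) *
        ((m : ℝ) ^ 4 * ‖a (m, l)‖ ^ 2 + (n : ℝ) ^ 4 * ‖a (n, l)‖ ^ 2) := by
        refine Finset.sum_le_sum fun n hn ↦ ?_
        have hmem : (m, n) ∈ {p : ℤ × ℤ | N < |p.1| + |p.2|} := (Finset.mem_filter.mp hn).2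
        rw [Set.indicator_of_mem hmem]
        exact two_mul_le_invSqWeight_mul (m, n) (by rintro rfl; simp [h.zero_left])
          (by rintro rfl; simp [h.zero_left])
    _ ≤ _ := hsum.sum_le_tsum s fun n _ ↦ mul_nonneg
        (Set.indicator_nonneg (fun p _ ↦ invSqWeight_nonneg p) _) (by positivity)

/-- The left side is the pairing of the square of an odd function with a Dirichlet kernel in the
first variable. -/
theorem exists_norm_sum_conv_le {κ : ℝ} (hκ : 0 < κ) :
    ∃ N : ℤ, 0 ≤ N ∧ ∀ (a : ℤ × ℤ → ℂ) (Z : ℝ), IsOddSpectrum a → (Summable fun ξ ↦ ‖a ξ‖ ^ 2) →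
      SumLE (fun ξ ↦ freqNorm ξ ^ 4 * ‖a ξ‖ ^ 2) Z →
      ‖∑ k ∈ Finset.Icc (-N) N, conv a a (k, 0)‖ ≤ κ * Z := by
  obtain ⟨N, hN, htail⟩ := exists_sumLE_indicator_lt summable_invSqWeight invSqWeight_nonneg
    (fun p ↦ |p.1| + |p.2|) hκ
  refine ⟨N, hN, fun a Z h h2 hZ ↦ ?_⟩
  have hfst : SumLE (fun ξ : ℤ × ℤ ↦ (ξ.1 : ℝ) ^ 4 * ‖a ξ‖ ^ 2) Z := by
    refine hZ.of_le (fun ξ ↦ by positivity) fun ξ ↦ ?_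
    have hpow := pow_le_pow_left₀ (abs_nonneg _) (abs_fst_le_freqNorm ξ) 4
    rw [Even.pow_abs (by decide : Even 4)] at hpow
    exact mul_le_mul_of_nonneg_right hpow (sq_nonneg _)
  have hmodes := SumLE.mul_add_of_prod (Set.indicator_nonneg fun p _ ↦ invSqWeight_nonneg p)
    (fun ξ ↦ by positivity) htail hfst
  have hterms : SumLE (fun ζ : ℤ × ℤ ↦ ‖∑ k ∈ Finset.Icc (-N) N, a ζ * a ((k, 0) - ζ)‖)
      (2⁻¹ * (2 * Z * κ)) :=
    (hmodes.tsum_fiber.const_mul (by norm_num)).of_le (fun _ ↦ norm_nonneg _) fun ζ ↦ by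
      linarith [h.two_mul_norm_sum_mul_le N ζ.1 ζ.2 (hmodes.summable.prod_factor ζ)]
  calc ‖∑ k ∈ Finset.Icc (-N) N, conv a a (k, 0)‖
      = ‖∑' ζ, ∑ k ∈ Finset.Icc (-N) N, a ζ * a ((k, 0) - ζ)‖ := by
        rw [Summable.tsum_finsetSum fun k _ ↦ summable_conv_apply h2 h2 (k, 0)]
        rfl
    _ ≤ ∑' ζ, ‖∑ k ∈ Finset.Icc (-N) N, a ζ * a ((k, 0) - ζ)‖ :=
        norm_tsum_le_tsum_norm hterms.summable
    _ ≤ κ * Z := hterms.tsum_le.trans_eq (by ring)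

end IsOddSpectrum

end LowModes

section Damping

/-- The pairing of the function with Fourier coefficients `x` with `-(2π)⁻² ∑ c k sin (k x)`. -/
noncomputable def sinePairing (S : Finset ℤ) (c : ℤ → ℝ) (x : ℤ × ℤ → ℂ) : ℝ :=
  ∑ k ∈ S, c k * (x (k, 0)).im

theorem abs_sinePairing_le (S : Finset ℤ) (c : ℤ → ℝ) {x : ℤ × ℤ → ℂ}
    (hx : Summable fun ξ ↦ ‖x ξ‖ ^ 2) :
    |sinePairing S c x| ≤ (∑ k ∈ S, |c k|) * √(∑' ξ, ‖x ξ‖ ^ 2) := by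
  rw [Finset.sum_mul]
  refine (Finset.abs_sum_le_sum_abs _ _).trans (Finset.sum_le_sum fun k _ ↦ ?_)
  rw [abs_mul]
  gcongr
  exact (Complex.abs_im_le_norm _).trans
    (Real.le_sqrt_of_sq_le (hx.le_tsum (k, 0) fun _ _ ↦ sq_nonneg _))

theorem sinePairing_spectralRhs {S : Finset ℤ} (hS : 0 ∉ S) (γ : ℝ) (L : ℤ × ℤ → ℝ)
    (x Q : ℤ × ℤ → ℂ) :
    sinePairing S (fun k ↦ -(2 * γ / k)) (spectralRhs L x Q) =
      γ * (∑ k ∈ S, Q (k, 0)).re + sinePairing S (fun k ↦ -(2 * γ / k) * L (k, 0)) x := by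
  rw [sinePairing, sinePairing, Complex.re_sum, Finset.mul_sum, ← Finset.sum_add_distrib]
  refine Finset.sum_congr rfl fun k hk ↦ ?_
  have hk0 : (k : ℝ) ≠ 0 := Int.cast_ne_zero.mpr (ne_of_mem_of_not_mem hk hS)
  have him : (spectralRhs L x Q (k, 0)).im =
      -(k / 2) * (Q (k, 0)).re + L (k, 0) * (x (k, 0)).im := by
    simp [spectralRhs]
  rw [him]
  field_simp
  ring

theorem IsSpectralFlow.isPrimitiveOn_sinePairing {L : ℤ × ℤ → ℝ} {x Q : ℝ → ℤ × ℤ → ℂ} {a b : ℝ}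
    (h : IsSpectralFlow L x Q a b) (hab : a ≤ b) (S : Finset ℤ) (c : ℤ → ℝ) :
    IsPrimitiveOn (fun t ↦ sinePairing S c (x t))
      (fun t ↦ sinePairing S c (spectralRhs L (x t) (Q t))) a b := by
  refine .of_hasDerivAt hab ?_ ?_ fun t ht ↦ ?_
  · exact continuousOn_finsetSum _ fun k _ ↦ continuousOn_const.mul
      (Complex.continuous_im.comp_continuousOn (h.continuousOn _))
  · exact continuousOn_finsetSum _ fun k _ ↦ continuousOn_const.mul
      (Complex.continuous_im.comp_continuousOn (h.continuousOn_spectralRhs _))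
  · exact HasDerivAt.fun_sum fun k _ ↦
      ((Complex.imCLM.hasFDerivAt.comp_hasDerivAt t (h.hasDerivAt (k, 0) t ht))).const_mul (c k)

/-- For `c k = -2γ / k` the pairing of `u u_x` is `γ` times the sum of the modes `(k, 0)`, `k ≠ 0`,
of `u²`. All modes together are small, hence these contribute `-γ` times the mean of `u²`. -/
theorem IsBiharmonicSymbol.exists_damping {ε : ℝ} {L : ℤ × ℤ → ℝ} (hL : IsBiharmonicSymbol ε L) :
    ∃ (S : Finset ℤ) (c : ℤ → ℝ) (C : ℝ), ∀ (a : ℤ × ℤ → ℂ) (B : ℝ), IsOddSpectrum a →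
      SumLE (fun ξ ↦ freqWeight ξ ^ 4 * ‖a ξ‖ ^ 2) B →
      ∑' ξ, energyRate L 0 a (conv a a) ξ + sinePairing S c (spectralRhs L a (conv a a)) ≤
        C * √(∑' ξ, ‖a ξ‖ ^ 2) - 2 * ∑' ξ, ‖a ξ‖ ^ 2 := by
  obtain ⟨A, hA, henergy⟩ := hL.exists_tsum_energyRate_conv_self_le
  have hγ : 0 < A + 2 := by positivity
  obtain ⟨N, hN, hmodes⟩ := IsOddSpectrum.exists_norm_sum_conv_le (div_pos hL.pos hγ)
  set S := (Finset.Icc (-N) N).erase 0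
  set d : ℤ → ℝ := fun k ↦ -(2 * (A + 2) / k) * L (k, 0)
  refine ⟨S, fun k ↦ -(2 * (A + 2) / k), ∑ k ∈ S, |d k|, fun a B ha hB ↦ ?_⟩
  have h2 := hB.sq_of_freqWeight_pow.summable
  have hsum : (∑ k ∈ S, conv a a (k, 0)).re ≤
      ε / (A + 2) * ∑' ξ, freqNorm ξ ^ 4 * ‖a ξ‖ ^ 2 - ∑' ξ, ‖a ξ‖ ^ 2 := by
    rw [Finset.sum_erase_eq_sub (by simpa using hN), Complex.sub_re]
    have := (Complex.re_le_norm _).trans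
      (hmodes a _ ha h2 (.of_hasSum hB.freqNorm_pow.summable.hasSum))
    rw [show ((0 : ℤ), (0 : ℤ)) = 0 from rfl, conv_self_zero ha.neg, Complex.ofReal_re]
    linarith
  rw [sinePairing_spectralRhs (Finset.notMem_erase _ _)]
  have hpair := (le_abs_self _).trans (abs_sinePairing_le S d h2)
  have hdamp := mul_le_mul_of_nonneg_left hsum hγ.le
  rw [mul_sub, ← mul_assoc, mul_div_cancel₀ _ hγ.ne'] at hdamp
  linarith [henergy a B ha.neg hB]

theorem IsBiharmonicSymbol.exists_energy_le {ε : ℝ} {L : ℤ × ℤ → ℝ} (hL : IsBiharmonicSymbol ε L)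
    {Y₀ : ℝ} (hY₀ : 0 ≤ Y₀) : ∃ C, 0 ≤ C ∧ ∀ a : ℝ → ℤ × ℤ → ℂ, IsSpectralSolution L a →
      (∀ ξ, a 0 (reflectFst ξ) = -a 0 ξ) → ∑' ξ, ‖a 0 ξ‖ ^ 2 ≤ Y₀ →
      ∀ t, 0 ≤ t → SumLE (fun ξ ↦ ‖a t ξ‖ ^ 2) C := by
  obtain ⟨S, c, C, hdamp⟩ := hL.exists_damping
  set D := ∑ k ∈ S, |c k|
  refine ⟨2 * (2 * Y₀ + C ^ 2 + D ^ 2) + D ^ 2, by positivity, fun a ha h0 hle₀ T hT ↦ ?_⟩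
  have hflow := ha.isSpectralFlow T
  obtain ⟨B, hB⟩ := hflow.bounded
  have hsum (t) (ht : t ∈ Set.Icc 0 T) := (hB t ht).sq_of_freqWeight_pow.summable
  have hnonneg (t : ℝ) : 0 ≤ ∑' ξ, ‖a t ξ‖ ^ 2 := tsum_nonneg fun ξ ↦ sq_nonneg _
  have hyoung (c t : ℝ) : c * √(∑' ξ, ‖a t ξ‖ ^ 2) ≤ (c ^ 2 + ∑' ξ, ‖a t ξ‖ ^ 2) / 2 := by
    nlinarith [two_mul_le_add_sq c √(∑' ξ, ‖a t ξ‖ ^ 2), Real.sq_sqrt (hnonneg t)]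
  have hpair (t) (ht : t ∈ Set.Icc 0 T) :=
    abs_le.mp ((abs_sinePairing_le S c (hsum t ht)).trans (hyoung D t))
  have hprim := (hflow.isPrimitiveOn_energy (ψ := 0) (n := 0) hL (by simp) hT).add
    (hflow.isPrimitiveOn_sinePairing hT S c)
  simp only [Pi.zero_apply, mul_zero, Real.exp_zero, one_mul] at hprim
  have hle := hprim.le_of_nonpos_above (M := 2 * Y₀ + C ^ 2 + D ^ 2) (t := T) ?_
    (fun t ht hlarge ↦ ?_) ⟨hT, le_rfl⟩
  · exact ⟨hsum T ⟨hT, le_rfl⟩, by linarith [(hpair T ⟨hT, le_rfl⟩).1]⟩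
  · linarith [(hpair 0 ⟨le_rfl, hT⟩).2, hnonneg 0, sq_nonneg C, sq_nonneg D]
  · refine (hdamp (a t) B ⟨ha.neg t, ha.odd hL h0 ht.1⟩ (hB t ht)).trans ?_
    linarith [(hpair t ht).2, hyoung C t, hnonneg 0, hnonneg t, sq_nonneg D]

end Damping

section Gevrey

theorem mul_norm_conv_le_conv {G R : Type*} [AddCommGroup G] [NormedCommRing R] {a b : G → R}
    {v : G → ℝ} (hv0 : ∀ ξ, 0 ≤ v ξ) (hv : ∀ ξ ζ, v ξ ≤ v ζ * v (ξ - ζ))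
    (ha : Summable fun ξ ↦ ‖a ξ‖ ^ 2) (hb : Summable fun ξ ↦ ‖b ξ‖ ^ 2)
    (hva : Summable fun ξ ↦ (v ξ * ‖a ξ‖) ^ 2) (hvb : Summable fun ξ ↦ (v ξ * ‖b ξ‖) ^ 2) (ξ : G) :
    v ξ * ‖conv a b ξ‖ ≤ conv (fun ζ ↦ v ζ * ‖a ζ‖) (fun ζ ↦ v ζ * ‖b ζ‖) ξ := by
  refine (mul_le_mul_of_nonneg_left (norm_conv_le_conv_norm ha hb ξ) (hv0 ξ)).trans ?_
  rw [conv, ← tsum_mul_left]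
  refine (((SumLE.of_hasSum ha.hasSum).conv_apply (.of_hasSum hb.hasSum) ξ).summable.mul_left
    _).tsum_le_tsum (fun ζ ↦ ?_)
    ((SumLE.of_hasSum hva.hasSum).conv_apply (.of_hasSum hvb.hasSum) ξ).summable
  calc v ξ * (‖a ζ‖ * ‖b (ξ - ζ)‖) ≤ v ζ * v (ξ - ζ) * (‖a ζ‖ * ‖b (ξ - ζ)‖) := by
        gcongr
        exact hv ξ ζ
    _ = v ζ * ‖a ζ‖ * (v (ξ - ζ) * ‖b (ξ - ζ)‖) := by ring

/-- The truncated frequency `min |ξ| n`. Unlike those with `|ξ|`, the Gevrey norms that it defines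
are finite from the outset, and it still is subadditive. -/
noncomputable def truncFreq (n : ℝ) (ξ : ℤ × ℤ) : ℝ := min (freqNorm ξ) n

theorem truncFreq_le_freqNorm (n : ℝ) (ξ : ℤ × ℤ) : truncFreq n ξ ≤ freqNorm ξ := min_le_left _ _

theorem truncFreq_le (n : ℝ) (ξ : ℤ × ℤ) : truncFreq n ξ ≤ n := min_le_right _ _

theorem abs_truncFreq_le {n : ℝ} (hn : 0 ≤ n) (ξ : ℤ × ℤ) : |truncFreq n ξ| ≤ n := by
  have hnonneg : 0 ≤ truncFreq n ξ := le_min (freqNorm_nonneg ξ) hn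
  exact (abs_of_nonneg hnonneg).trans_le (truncFreq_le n ξ)

theorem truncFreq_le_add {n : ℝ} (hn : 0 ≤ n) (ξ ζ : ℤ × ℤ) :
    truncFreq n ξ ≤ truncFreq n ζ + truncFreq n (ξ - ζ) := by
  have htriangle := freqNorm_add_le ζ (ξ - ζ)
  rw [add_sub_cancel] at htriangle
  simp only [truncFreq, min_add, add_min, le_min_iff, min_le_iff]
  have := freqNorm_nonneg ζ
  have := freqNorm_nonneg (ξ - ζ)
  exact ⟨⟨.inl htriangle, .inr (by linarith)⟩, .inr (by linarith), .inr (by linarith)⟩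

theorem exp_two_mul_mul_eq_sq (s x : ℝ) : Real.exp (2 * s * x) = Real.exp (s * x) ^ 2 := by
  rw [mul_assoc, ← Real.exp_nat_mul, Nat.cast_ofNat]

theorem SumLE.exp_truncFreq_mul {n s A : ℝ} (hs : 0 ≤ s) {k : ℕ} {a : ℤ × ℤ → ℂ}
    (ha : SumLE (fun ξ ↦ freqWeight ξ ^ k * ‖a ξ‖ ^ 2) A) :
    SumLE (fun ξ ↦ freqWeight ξ ^ k * (Real.exp (s * truncFreq n ξ) * ‖a ξ‖) ^ 2)
      (Real.exp (s * n) ^ 2 * A) := by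
  refine (ha.const_mul (sq_nonneg _)).of_le
    (fun ξ ↦ by have := freqWeight_pos ξ; positivity) fun ξ ↦ ?_
  have := freqWeight_pos ξ
  calc freqWeight ξ ^ k * (Real.exp (s * truncFreq n ξ) * ‖a ξ‖) ^ 2
      ≤ freqWeight ξ ^ k * (Real.exp (s * n) * ‖a ξ‖) ^ 2 := by gcongr; exact truncFreq_le n ξ
    _ = Real.exp (s * n) ^ 2 * (freqWeight ξ ^ k * ‖a ξ‖ ^ 2) := by ring

namespace IsBiharmonicSymbol

variable {ε : ℝ} {L : ℤ × ℤ → ℝ}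

theorem tsum_exp_mul_energyRate_le (hL : IsBiharmonicSymbol ε L) {n s A B K : ℝ}
    {a : ℤ × ℤ → ℂ} (hn : 0 ≤ n) (hs : 0 ≤ s) (hK0 : 0 ≤ K)
    (hK : ∀ ξ, freqNorm ξ + L ξ + √weightConst * √B / 2 * freqWeight ξ ^ 3 ≤ K)
    (ha : SumLE (fun ξ ↦ freqWeight ξ ^ 4 * ‖a ξ‖ ^ 2) A)
    (hB : ∑' ξ, Real.exp (2 * s * truncFreq n ξ) * ‖a ξ‖ ^ 2 ≤ B) :
    ∑' ξ, Real.exp (2 * s * truncFreq n ξ) * energyRate L (truncFreq n) a (conv a a) ξ ≤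
      2 * K * B := by
  simp only [exp_two_mul_mul_eq_sq, ← mul_pow] at hB ⊢
  set b := fun ξ ↦ Real.exp (s * truncFreq n ξ) * ‖a ξ‖
  have hb0 (ξ : ℤ × ℤ) : 0 ≤ b ξ := by positivity
  have hb4 : SumLE (fun ξ ↦ freqWeight ξ ^ 4 * b ξ ^ 2) _ := ha.exp_truncFreq_mul hs
  have hb3 := SumLE.of_hasSum (hb4.freqWeight_pow_mono (m := 3) (by norm_num)).summable.hasSum
  have hb2 : SumLE (fun ξ ↦ b ξ ^ 2) B := ⟨hb4.sq_of_freqWeight_pow.summable, hB⟩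
  have ha2 := ha.sq_of_freqWeight_pow.summable
  have hforce := mul_norm_conv_le_conv (v := fun ξ ↦ Real.exp (s * truncFreq n ξ))
    (fun ξ ↦ (Real.exp_pos _).le) (fun ξ ζ ↦ by
      rw [← Real.exp_add, ← mul_add]
      gcongr
      exact truncFreq_le_add hn ξ ζ) ha2 ha2 hb2.summable hb2.summable
  have hconv := SumLE.freqNorm_mul_conv hb0 hb0 hb0 hb3 hb3.of_freqWeight_cube hb2
  set X := ∑' ξ, freqWeight ξ ^ 3 * b ξ ^ 2
  have hX : √X * √B * (√weightConst * √X) = √weightConst * √B * X := by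
    rw [← Real.mul_self_sqrt (hb3.nonneg fun ξ ↦ by have := freqWeight_pos ξ; positivity : 0 ≤ X)]
    simp only [Real.sqrt_mul_self (Real.sqrt_nonneg X)]
    ring
  rw [hX] at hconv
  refine (hL.tsum_sq_mul_energyRate_le (abs_truncFreq_le hn) (fun ξ ↦ (Real.exp_pos _).le) hb4
    hforce hconv fun ξ ↦ ?_).trans (mul_le_mul_of_nonneg_left hB (by positivity))
  linarith [hK ξ, truncFreq_le_freqNorm n ξ]

theorem exists_truncated_gevrey_le (hL : IsBiharmonicSymbol ε L) {C B : ℝ} (hC : 0 ≤ C)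
    (hCB : C < B) :
    ∃ τ, 0 < τ ∧ ∀ a : ℝ → ℤ × ℤ → ℂ, IsSpectralSolution L a → ∀ t₀, 0 ≤ t₀ →
      ∑' ξ, ‖a t₀ ξ‖ ^ 2 ≤ C → ∀ s ∈ Set.Icc 0 τ, ∀ n, 0 ≤ n →
        ∑' ξ, Real.exp (2 * s * truncFreq n ξ) * ‖a (t₀ + s) ξ‖ ^ 2 ≤ B := by
  have hB : 0 < B := hC.trans_lt hCB
  obtain ⟨K, hK0, hLK⟩ := hL.exists_add_cube_le (√weightConst * √B / 2 + 1)
  have hK (ξ : ℤ × ℤ) :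
      freqNorm ξ + L ξ + √weightConst * √B / 2 * freqWeight ξ ^ 3 ≤ K := by
    have hcube : freqNorm ξ ≤ freqWeight ξ ^ 3 :=
      (freqNorm_le_freqWeight ξ).trans (le_self_pow₀ (one_le_freqWeight ξ) (by norm_num))
    have := hL.pos
    linarith [hLK ξ, show 0 ≤ ε / 2 * freqNorm ξ ^ 4 by positivity]
  obtain ⟨τ, hτ, hτB⟩ : ∃ τ, 0 < τ ∧ 2 * K * B * τ < B - C := exists_pos_mul_lt (sub_pos.mpr hCB) _
  refine ⟨τ, hτ, fun a ha t₀ ht₀ hy₀ s hs n hn ↦ ?_⟩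
  have hflow := (ha.isSpectralFlow (t₀ + τ)).mono ht₀ le_rfl
  obtain ⟨A, hA⟩ := hflow.bounded
  have hprim := hflow.isPrimitiveOn_energy hL (abs_truncFreq_le hn) (by linarith)
  have hle := hprim.le_of_le_below (M := 2 * K * B) (B₀ := C) (B := B) (t := t₀ + s)
    (by positivity) (by simpa using hy₀) (fun r hr hrB ↦ hL.tsum_exp_mul_energyRate_le hn
      (sub_nonneg.mpr hr.1) hK0 hK (hA r hr) hrB)
    (by rw [add_sub_cancel_left]; linarith) ⟨by linarith [hs.1], by linarith [hs.2]⟩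
  simpa only [add_sub_cancel_left] using hle

theorem exists_gevrey_le (hL : IsBiharmonicSymbol ε L) {C B : ℝ} (hC : 0 ≤ C) (hCB : C < B) :
    ∃ τ, 0 < τ ∧ ∀ a : ℝ → ℤ × ℤ → ℂ, IsSpectralSolution L a → ∀ t₀, 0 ≤ t₀ →
      ∑' ξ, ‖a t₀ ξ‖ ^ 2 ≤ C → ∀ s ∈ Set.Icc 0 τ,
        SumLE (fun ξ ↦ Real.exp (2 * s * freqNorm ξ) * ‖a (t₀ + s) ξ‖ ^ 2) B := by
  obtain ⟨τ, hτ, hle⟩ := hL.exists_truncated_gevrey_le hC hCB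
  refine ⟨τ, hτ, fun a ha t₀ ht₀ hy₀ s hs ↦ .of_sum_le (fun ξ ↦ by positivity) fun u ↦ ?_⟩
  obtain ⟨A, hA⟩ := (ha.isSpectralFlow (t₀ + s)).bounded
  have hA' := hA (t₀ + s) ⟨add_nonneg ht₀ hs.1, le_rfl⟩
  set n := ∑ ξ ∈ u, freqNorm ξ
  have hsum : Summable fun ξ ↦ Real.exp (2 * s * truncFreq n ξ) * ‖a (t₀ + s) ξ‖ ^ 2 := by
    simpa only [exp_two_mul_mul_eq_sq, ← mul_pow] using
      (hA'.exp_truncFreq_mul hs.1).sq_of_freqWeight_pow.summable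
  calc ∑ ξ ∈ u, Real.exp (2 * s * freqNorm ξ) * ‖a (t₀ + s) ξ‖ ^ 2
      = ∑ ξ ∈ u, Real.exp (2 * s * truncFreq n ξ) * ‖a (t₀ + s) ξ‖ ^ 2 :=
        Finset.sum_congr rfl fun ξ hξ ↦ by
          rw [truncFreq, min_eq_left (Finset.single_le_sum (fun ζ _ ↦ freqNorm_nonneg ζ) hξ)]
    _ ≤ ∑' ξ, Real.exp (2 * s * truncFreq n ξ) * ‖a (t₀ + s) ξ‖ ^ 2 :=
        hsum.sum_le_tsum u fun ξ _ ↦ by positivity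
    _ ≤ B := hle a ha t₀ ht₀ hy₀ s hs n (Finset.sum_nonneg fun ξ _ ↦ freqNorm_nonneg ξ)

end IsBiharmonicSymbol

end Gevrey

section AnalyticExtension

theorem hasFPowerSeriesOnBall_tsum {ι 𝕜 E F : Type*} [NontriviallyNormedField 𝕜]
    [NormedAddCommGroup E] [NormedSpace 𝕜 E] [NormedAddCommGroup F] [NormedSpace 𝕜 F]
    [CompleteSpace F] {f : ι → E → F} {p : ι → FormalMultilinearSeries 𝕜 E F} {x : E} {r : NNReal}
    (hr : 0 < r) (hf : ∀ i, HasFPowerSeriesOnBall (f i) (p i) x r)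
    (hp : Summable fun q : ι × ℕ ↦ ‖p q.1 q.2‖ * (r : ℝ) ^ q.2) :
    HasFPowerSeriesOnBall (fun z ↦ ∑' i, f i z) (fun n ↦ ∑' i, p i n) x r := by
  have hcol : Summable fun q : ℕ × ι ↦ ‖p q.2 q.1‖ * (r : ℝ) ^ q.1 := hp.prod_symm
  have hpn (n : ℕ) : Summable fun i ↦ ‖p i n‖ := by
    have hrn : (r : ℝ) ^ n ≠ 0 := by positivity
    simpa [mul_assoc, mul_inv_cancel₀ hrn] using (hcol.prod_factor n).mul_right ((r : ℝ) ^ n)⁻¹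
  refine ⟨FormalMultilinearSeries.le_radius_of_summable _ ?_, by exact_mod_cast hr, fun {w} hw ↦ ?_⟩
  · refine .of_nonneg_of_le (fun n ↦ by positivity) (fun n ↦ ?_) hcol.prod
    calc ‖∑' i, p i n‖ * (r : ℝ) ^ n ≤ (∑' i, ‖p i n‖) * (r : ℝ) ^ n := by
          gcongr
          exact norm_tsum_le_tsum_norm (hpn n)
      _ = ∑' i, ‖p i n‖ * (r : ℝ) ^ n := tsum_mul_right.symm
  · have hwr : ‖w‖ ≤ r := by
      rw [Metric.mem_eball, edist_zero_right, enorm_lt_coe] at hw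
      exact_mod_cast hw.le
    have hterm (i : ι) (n : ℕ) : ‖p i n fun _ ↦ w‖ ≤ ‖p i n‖ * (r : ℝ) ^ n := by
      simpa using (p i n).le_opNorm_mul_prod_of_le fun _ ↦ hwr
    have hsum : Summable fun q : ℕ × ι ↦ p q.2 q.1 fun _ ↦ w :=
      .of_norm_bounded hcol fun q ↦ hterm q.2 q.1
    have heval (n : ℕ) : (∑' i, p i n) (fun _ ↦ w) = ∑' i, p i n fun _ ↦ w :=
      ContinuousMultilinearMap.tsum_eval (hpn n).of_norm _
    have hf' : ∑' n, ∑' i, (p i n fun _ ↦ w) = ∑' i, f i (x + w) := by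
      rw [← Summable.tsum_comm (f := fun n i ↦ p i n fun _ ↦ w) hsum]
      exact tsum_congr fun i ↦ ((hf i).hasSum hw).tsum_eq
    simpa only [heval, hf'] using hsum.prod.hasSum

section Exponential

variable {E : Type*} [NormedAddCommGroup E] [NormedSpace ℂ E]

theorem hasFPowerSeriesOnBall_mul_exp (c : ℂ) (l : E →L[ℂ] ℂ) (z₀ : E) :
    HasFPowerSeriesOnBall (fun z ↦ c * Complex.exp (l z))
      ((c * Complex.exp (l z₀)) • (NormedSpace.expSeries ℂ ℂ).compContinuousLinearMap l) z₀ ⊤ := by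
  have hexp : HasFPowerSeriesOnBall NormedSpace.exp (NormedSpace.expSeries ℂ ℂ) (l 0) ⊤ := by
    simpa using NormedSpace.exp_hasFPowerSeriesOnBall (𝕂 := ℂ) (𝔸 := ℂ)
  have hcomp := (hexp.compContinuousLinearMap.comp_sub z₀).const_smul (c := c * Complex.exp (l z₀))
  rw [zero_add, ENNReal.top_div_of_ne_top enorm_ne_top] at hcomp
  refine hcomp.congr fun z _ ↦ ?_
  simp only [Pi.smul_apply, Function.comp_apply, smul_eq_mul, ← Complex.exp_eq_exp_ℂ, mul_assoc,
    ← Complex.exp_add, map_sub, add_sub_cancel]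

theorem norm_smul_expSeries_compContinuousLinearMap_mul_pow_le (c : ℂ) (l : E →L[ℂ] ℂ) {ρ : ℝ}
    (hρ : 0 ≤ ρ) (n : ℕ) :
    ‖(c • (NormedSpace.expSeries ℂ ℂ).compContinuousLinearMap l) n‖ * ρ ^ n ≤
      ‖c‖ * ((‖l‖ * ρ) ^ n / n.factorial) := by
  have hnorm : ‖NormedSpace.expSeries ℂ ℂ n‖ = (n.factorial : ℝ)⁻¹ := by
    rw [NormedSpace.expSeries, norm_smul, norm_inv, Complex.norm_natCast,
      ContinuousMultilinearMap.norm_mkPiAlgebraFin, mul_one]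
  have hcomp := (NormedSpace.expSeries ℂ ℂ).norm_compContinuousLinearMap_le l n
  calc ‖c • (NormedSpace.expSeries ℂ ℂ).compContinuousLinearMap l n‖ * ρ ^ n
      ≤ ‖c‖ * ((n.factorial : ℝ)⁻¹ * ‖l‖ ^ n) * ρ ^ n := by
        rw [norm_smul, ← hnorm]
        gcongr
    _ = ‖c‖ * ((‖l‖ * ρ) ^ n / n.factorial) := by ring

theorem summable_mul_pow_div_factorial {ι : Type*} {a b : ι → ℝ} (ha : ∀ i, 0 ≤ a i)
    (hb : ∀ i, 0 ≤ b i) (h : Summable fun i ↦ a i * Real.exp (b i)) :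
    Summable fun q : ι × ℕ ↦ a q.1 * (b q.1 ^ q.2 / q.2.factorial) := by
  have hexp (x : ℝ) : HasSum (fun n : ℕ ↦ x ^ n / n.factorial) (Real.exp x) := by
    rw [Real.exp_eq_exp_ℝ]
    exact NormedSpace.expSeries_div_hasSum_exp x
  have hnonneg (q : ι × ℕ) : 0 ≤ a q.1 * (b q.1 ^ q.2 / q.2.factorial) :=
    mul_nonneg (ha _) (div_nonneg (pow_nonneg (hb _) _) (Nat.cast_nonneg _))
  have hfiber (i : ι) := (hexp (b i)).mul_left (a i)
  refine (summable_prod_of_nonneg hnonneg).mpr ⟨fun i ↦ (hfiber i).summable, ?_⟩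
  exact h.congr fun i ↦ (hfiber i).tsum_eq.symm

/-- The slack `ρ` in the exponent is the radius of convergence of the power series at `z₀`. -/
theorem analyticAt_tsum_mul_exp {ι : Type*} (c : ι → ℂ) (l : ι → E →L[ℂ] ℂ) (z₀ : E) {ρ : ℝ}
    (hρ : 0 < ρ) (h : Summable fun i ↦ ‖c i * Complex.exp (l i z₀)‖ * Real.exp (‖l i‖ * ρ)) :
    AnalyticAt ℂ (fun z ↦ ∑' i, c i * Complex.exp (l i z)) z₀ := by
  have hρ' : 0 < ρ.toNNReal := Real.toNNReal_pos.mpr hρ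
  have hseries (i : ι) := (hasFPowerSeriesOnBall_mul_exp (c i) (l i) z₀).mono
    (by exact_mod_cast hρ') (le_top (a := (ρ.toNNReal : ENNReal)))
  refine (hasFPowerSeriesOnBall_tsum hρ' hseries ?_).analyticAt
  have hmajorant := summable_mul_pow_div_factorial
    (fun i ↦ norm_nonneg (c i * Complex.exp (l i z₀)))
    (fun i ↦ mul_nonneg (norm_nonneg (l i)) hρ.le) h
  have hbound (q : ι × ℕ) := norm_smul_expSeries_compContinuousLinearMap_mul_pow_le
    (c q.1 * Complex.exp (l q.1 z₀)) (l q.1) hρ.le q.2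
  rw [Real.coe_toNNReal ρ hρ.le]
  exact hmajorant.of_nonneg_of_le (fun q ↦ mul_nonneg (norm_nonneg _) (by positivity)) hbound

end Exponential

theorem freqWeight_cube_le_mul_exp {κ : ℝ} (hκ : 0 < κ) (ξ : ℤ × ℤ) :
    freqWeight ξ ^ 3 ≤ 6 / κ ^ 3 * Real.exp κ * Real.exp (κ * freqNorm ξ) := by
  have hcube := Real.pow_div_factorial_le_exp (κ * freqWeight ξ)
    (mul_nonneg hκ.le (freqWeight_pos ξ).le) 3
  rw [mul_assoc, ← Real.exp_add,
    show κ + κ * freqNorm ξ = κ * freqWeight ξ by rw [freqWeight]; ring]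
  calc freqWeight ξ ^ 3 = 6 / κ ^ 3 * ((κ * freqWeight ξ) ^ 3 / Nat.factorial 3) := by
        norm_num [Nat.factorial]
        field_simp
    _ ≤ 6 / κ ^ 3 * Real.exp (κ * freqWeight ξ) := by gcongr

theorem summable_exp_mul_norm {c : ℤ × ℤ → ℂ} {σ r : ℝ} (hr : r < σ)
    (hc : Summable fun ξ ↦ Real.exp (2 * σ * freqNorm ξ) * ‖c ξ‖ ^ 2) :
    Summable fun ξ ↦ Real.exp (r * freqNorm ξ) * ‖c ξ‖ := by
  set κ := 2 * (σ - r) with hκ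
  have hκ0 : 0 < κ := by linarith
  have hsplit (ξ : ℤ × ℤ) : Real.exp (2 * σ * freqNorm ξ) =
      Real.exp (κ * freqNorm ξ) * Real.exp (r * freqNorm ξ) ^ 2 := by
    rw [← exp_two_mul_mul_eq_sq, ← Real.exp_add, hκ]
    ring_nf
  refine (SumLE.of_freqWeight_cube (SumLE.of_le (.of_hasSum
    (hc.mul_left (6 / κ ^ 3 * Real.exp κ)).hasSum) (fun ξ ↦ ?_) fun ξ ↦ ?_)).summable
  · have := freqWeight_pos ξ
    positivity
  · rw [hsplit, mul_pow, mul_assoc _ _ (‖c ξ‖ ^ 2), ← mul_assoc _ (Real.exp (κ * freqNorm ξ))]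
    gcongr
    exact freqWeight_cube_le_mul_exp hκ0 ξ

/-- The phase `z ↦ i ξ·z` of the character of frequency `ξ`, extended to `ℂ²`. -/
noncomputable def phaseForm (ξ : ℤ × ℤ) : ℂ × ℂ →L[ℂ] ℂ :=
  (Complex.I * (ξ.1 : ℂ)) • ContinuousLinearMap.fst ℂ ℂ ℂ +
    (Complex.I * (ξ.2 : ℂ)) • ContinuousLinearMap.snd ℂ ℂ ℂ

theorem phaseForm_apply (ξ : ℤ × ℤ) (z : ℂ × ℂ) :
    phaseForm ξ z = Complex.I * (ξ.1 : ℂ) * z.1 + Complex.I * (ξ.2 : ℂ) * z.2 := by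
  simp [phaseForm]

theorem norm_phaseForm_le (ξ : ℤ × ℤ) : ‖phaseForm ξ‖ ≤ 2 * freqNorm ξ := by
  have hξ := freqNorm_nonneg ξ
  refine ContinuousLinearMap.opNorm_le_bound _ (by positivity) fun z ↦ ?_
  calc ‖phaseForm ξ z‖ ≤ |(ξ.1 : ℝ)| * ‖z.1‖ + |(ξ.2 : ℝ)| * ‖z.2‖ := by
        simpa [phaseForm_apply] using
          norm_add_le (Complex.I * (ξ.1 : ℂ) * z.1) (Complex.I * (ξ.2 : ℂ) * z.2)
    _ ≤ freqNorm ξ * ‖z‖ + freqNorm ξ * ‖z‖ := by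
        gcongr
        exacts [abs_fst_le_freqNorm ξ, norm_fst_le z, abs_snd_le_freqNorm ξ, norm_snd_le z]
    _ = 2 * freqNorm ξ * ‖z‖ := by ring

theorem norm_exp_phaseForm_le (ξ : ℤ × ℤ) (z : ℂ × ℂ) :
    ‖Complex.exp (phaseForm ξ z)‖ ≤ Real.exp (√(z.1.im ^ 2 + z.2.im ^ 2) * freqNorm ξ) := by
  have hre : (phaseForm ξ z).re = -((ξ.1 : ℝ) * z.1.im + (ξ.2 : ℝ) * z.2.im) := by
    simp [phaseForm_apply]
    ring
  rw [Complex.norm_exp, Real.exp_le_exp, hre, freqNorm, ← Real.sqrt_mul (by positivity)]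
  apply Real.le_sqrt_of_sq_le
  linarith [sq_nonneg ((ξ.1 : ℝ) * z.2.im - (ξ.2 : ℝ) * z.1.im)]

theorem torusChar_coe (ξ : ℤ × ℤ) (x y : ℝ) :
    torusChar ξ ((x : AddCircle (2 * Real.pi)), (y : AddCircle (2 * Real.pi))) =
      Complex.exp (phaseForm ξ ((x : ℂ), (y : ℂ))) := by
  have : (2 * Real.pi : ℂ) ≠ 0 := by exact_mod_cast two_pi_ne_zero_complex
  rw [torusChar_apply, fourier_coe_apply, fourier_coe_apply, phaseForm_apply, Complex.exp_add]
  push_cast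
  congr 2 <;> field_simp

theorem quasiMeasurePreserving_coe_addCircle (T : ℝ) [hT : Fact (0 < T)] :
    Measure.QuasiMeasurePreserving (fun x : ℝ ↦ (x : AddCircle T)) := by
  refine ⟨AddCircle.measurable_mk', .mk fun s hs hs0 ↦ ?_⟩
  rw [Measure.map_apply AddCircle.measurable_mk' hs,
    ← Set.inter_univ ((fun x : ℝ ↦ (x : AddCircle T)) ⁻¹' s), ← iUnion_Ioc_zsmul hT.out,
    Set.inter_iUnion, measure_iUnion_null_iff]
  intro n
  have hperiod := (AddCircle.measurePreserving_mk T (n • T)).measure_preimage hs.nullMeasurableSet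
  rwa [hs0, Measure.restrict_apply (AddCircle.measurable_mk' hs), ← add_one_zsmul] at hperiod

theorem ae_coe_torus {P : Torus2 → Prop} (h : ∀ᵐ p : Torus2, P p) :
    ∀ᵐ p : ℝ × ℝ, P ((p.1 : AddCircle (2 * Real.pi)), (p.2 : AddCircle (2 * Real.pi))) :=
  have hcoe := quasiMeasurePreserving_coe_addCircle (2 * Real.pi)
  (QuasiMeasurePreserving.prodMap hcoe hcoe).ae h

theorem analyticAt_tsum_mul_exp_phaseForm {c : ℤ × ℤ → ℂ} {σ : ℝ}
    (hc : Summable fun ξ ↦ Real.exp (2 * σ * freqNorm ξ) * ‖c ξ‖ ^ 2) {z : ℂ × ℂ}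
    (hz : z ∈ complexStrip σ) :
    AnalyticAt ℂ (fun w ↦ ∑' ξ, c ξ * Complex.exp (phaseForm ξ w)) z := by
  set r := √(z.1.im ^ 2 + z.2.im ^ 2)
  have hrσ : r < σ := hz
  refine analyticAt_tsum_mul_exp _ _ z (ρ := (σ - r) / 4) (by linarith) ?_
  have hsum := summable_exp_mul_norm (r := r + (σ - r) / 2) (by linarith) hc
  refine hsum.of_nonneg_of_le (fun ξ ↦ by positivity) fun ξ ↦ ?_
  have : 0 < (σ - r) / 4 := by linarith
  calc ‖c ξ * Complex.exp (phaseForm ξ z)‖ * Real.exp (‖phaseForm ξ‖ * ((σ - r) / 4))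
      ≤ ‖c ξ‖ * Real.exp (r * freqNorm ξ) * Real.exp (2 * freqNorm ξ * ((σ - r) / 4)) := by
        rw [norm_mul]
        gcongr
        exacts [norm_exp_phaseForm_le ξ z, norm_phaseForm_le ξ]
    _ = Real.exp ((r + (σ - r) / 2) * freqNorm ξ) * ‖c ξ‖ := by
        rw [mul_assoc, ← Real.exp_add, mul_comm]
        ring_nf

theorem analyticInStrip_of_summable {u : L2Torus} {σ : ℝ} (hσ : 0 < σ)
    (hu : Summable fun ξ ↦ Real.exp (2 * σ * freqNorm ξ) * ‖fourierCoeff2 u ξ‖ ^ 2) :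
    AnalyticInStrip σ u := by
  have hsum : Summable fun ξ ↦ ‖fourierCoeff2 u ξ‖ := by simpa using summable_exp_mul_norm hσ hu
  refine ⟨fun z ↦ ∑' ξ, fourierCoeff2 u ξ * Complex.exp (phaseForm ξ z),
    fun z hz ↦ analyticAt_tsum_mul_exp_phaseForm hu hz, ?_⟩
  filter_upwards [ae_coe_torus (ae_eq_tsum_torusChar u hsum)] with p hp
  simp only [hp, torusChar_coe]

end AnalyticExtension

section StripWidth

variable {T₀ t : ℝ}

theorem real_tanh_pos (ht : 0 < t) : 0 < Real.tanh t := by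
  rw [Real.tanh_eq_sinh_div_cosh]
  exact div_pos (Real.sinh_pos_iff.mpr ht) (Real.cosh_pos t)

theorem real_tanh_le_self (ht : 0 < t) : Real.tanh t ≤ t := by
  obtain ⟨c, ⟨hc0, hct⟩, hc⟩ := exists_hasDerivAt_eq_slope Real.sinh Real.cosh ht
    Real.continuous_sinh.continuousOn fun x _ ↦ Real.hasDerivAt_sinh x
  have hcosh : Real.cosh c ≤ Real.cosh t := by
    rw [Real.cosh_le_cosh, abs_of_pos hc0, abs_of_pos ht]
    exact hct.le
  rw [Real.sinh_zero, sub_zero, sub_zero, eq_div_iff ht.ne'] at hc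
  rw [Real.tanh_eq_sinh_div_cosh, div_le_iff₀ (Real.cosh_pos t), ← hc, mul_comm]
  gcongr

theorem stripWidth_pos (hT : 0 < T₀) (ht : 0 < t) : 0 < stripWidth T₀ t :=
  lt_min (real_tanh_pos ht) (real_tanh_pos (half_pos hT))

theorem stripWidth_le (hT : 0 < T₀) (ht : 0 < t) : stripWidth T₀ t ≤ min t (T₀ / 2) :=
  min_le_min (real_tanh_le_self ht) (real_tanh_le_self (half_pos hT))

end StripWidth

theorem norm_le_of_sumLE {u : L2Torus} {Y : ℝ} (h : SumLE (fun ξ ↦ ‖fourierCoeff2 u ξ‖ ^ 2) Y) :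
    ‖u‖ ≤ 2 * Real.pi * √Y := by
  have hY := h.tsum_le
  have hY0 : 0 ≤ Y := h.nonneg fun ξ ↦ by positivity
  rw [(hasSum_norm_sq_fourierCoeff2 u).tsum_eq, inv_mul_le_iff₀ (by positivity),
    ← Real.sq_sqrt hY0, ← mul_pow] at hY
  exact le_of_sq_le_sq hY (by positivity)

theorem tsum_norm_sq_fourierCoeff2_le {u : L2Torus} {R : ℝ} (hu : ‖u‖ ≤ R) :
    ∑' ξ, ‖fourierCoeff2 u ξ‖ ^ 2 ≤ ((2 * Real.pi) ^ 2)⁻¹ * R ^ 2 := by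
  rw [(hasSum_norm_sq_fourierCoeff2 u).tsum_eq]
  gcongr

theorem gevreySq_le_and_analyticInStrip {u : L2Torus} {σ s R : ℝ} (hσ : 0 < σ) (hσs : σ ≤ s)
    (hu : SumLE (fun ξ ↦ Real.exp (2 * s * freqNorm ξ) * ‖fourierCoeff2 u ξ‖ ^ 2) R) :
    gevreySq σ u ≤ ENNReal.ofReal ((2 * Real.pi) ^ 2 * R) ∧ AnalyticInStrip σ u := by
  have hσu : SumLE (fun ξ ↦ Real.exp (2 * σ * freqNorm ξ) * ‖fourierCoeff2 u ξ‖ ^ 2) R := by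
    refine hu.of_le (fun ξ ↦ by positivity) fun ξ ↦ ?_
    have := freqNorm_nonneg ξ
    gcongr
  refine ⟨?_, analyticInStrip_of_summable hσ hσu.summable⟩
  have h := hσu.const_mul (c := (2 * Real.pi) ^ 2) (by positivity)
  rw [gevreySq, ← ENNReal.ofReal_tsum_of_nonneg (fun ξ ↦ by positivity) h.summable]
  exact ENNReal.ofReal_le_ofReal h.tsum_le

theorem mainTheorem4_general (ε β δ : ℝ) (hε : 0 < ε) (R : ℝ) :
    ∃ T₀ : ℝ, 0 < T₀ ∧ ∃ C : ℝ, ∀ (η₀ : L2Torus) (η : ℝ → L2Torus), ‖η₀‖ ≤ R →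
      (∀ᵐ p : Torus2, η₀ (-p.1, p.2) = -η₀ p) → IsSolution ε β δ η₀ η →
      (∀ t : ℝ, 0 ≤ t → ‖η t‖ ≤ C) ∧
      ∀ t : ℝ, 0 < t →
        gevreySq (stripWidth T₀ t) (η t) ≤ ENNReal.ofReal (1 + 2 * C ^ 2) ∧
        AnalyticInStrip (stripWidth T₀ t) (η t) := by
  have hL := isBiharmonicSymbol_linearSymbol hε β δ
  obtain ⟨Y, hY, henergy⟩ := hL.exists_energy_le (Y₀ := ((2 * Real.pi) ^ 2)⁻¹ * R ^ 2)
    (by positivity)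
  have hpi : 0 < ((2 * Real.pi) ^ 2)⁻¹ := by positivity
  obtain ⟨τ, hτ, hgevrey⟩ := hL.exists_gevrey_le (B := ((2 * Real.pi) ^ 2)⁻¹ + 2 * Y) hY
    (by linarith)
  refine ⟨2 * τ, by positivity, 2 * Real.pi * √Y, fun η₀ η hR hodd hη ↦ ?_⟩
  have hbound : ∀ t, 0 ≤ t → SumLE (fun ξ ↦ ‖fourierCoeff2 (η t) ξ‖ ^ 2) Y := by
    refine henergy _ hη.isSpectralSolution ?_ ?_ <;> rw [hη.initial]
    exacts [fourierCoeff2_reflectFst η₀ hodd, tsum_norm_sq_fourierCoeff2_le hR]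
  refine ⟨fun t ht ↦ norm_le_of_sumLE (hbound t ht), fun t ht ↦ ?_⟩
  have hstart : 0 ≤ t - min t τ := sub_nonneg.mpr (min_le_left t τ)
  have hsum := hgevrey _ hη.isSpectralSolution _ hstart (hbound _ hstart).tsum_le (min t τ)
    ⟨(lt_min ht hτ).le, min_le_right t τ⟩
  have hconst : (2 * Real.pi) ^ 2 * (((2 * Real.pi) ^ 2)⁻¹ + 2 * Y) =
      1 + 2 * (2 * Real.pi * √Y) ^ 2 := by
    rw [mul_pow _ √Y, Real.sq_sqrt hY]
    field_simp
  rw [← hconst]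
  have hwidth := stripWidth_le (T₀ := 2 * τ) (by positivity) ht
  rw [mul_div_cancel_left₀ τ two_ne_zero] at hwidth
  rw [sub_add_cancel] at hsum
  exact gevreySq_le_and_analyticInStrip (stripWidth_pos (by positivity) ht) hwidth hsum

theorem mainTheorem4 (ε β δ : ℝ) (hε : 0 < ε) (hβ : 0 < β) (hδ : 0 ≤ δ)
    (η₀ : L2Torus) (hη₀ : IsH2Odd η₀) :
    ∃ T₀ : ℝ, 0 < T₀ ∧ ∃ C : ℝ, ∀ η : ℝ → L2Torus, IsSolution ε β δ η₀ η →
      (∀ t : ℝ, 0 ≤ t → ‖η t‖ ≤ C) ∧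
      ∀ t : ℝ, 0 < t →
        gevreySq (stripWidth T₀ t) (η t) ≤ ENNReal.ofReal (1 + 2 * C ^ 2) ∧
        AnalyticInStrip (stripWidth T₀ t) (η t) := by
  obtain ⟨T₀, hT₀, C, h⟩ := mainTheorem4_general ε β δ hε ‖η₀‖
  exact ⟨T₀, hT₀, C, fun η ↦ h η₀ η le_rfl hη₀.2⟩
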